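/- Let $R$ be a commutative ring and let $\Gamma=\mathbb{R}^{\ge 0}\cup\{\infty\}$. A \emph{length function} on $R$ is a map $\ell$ from $R$-modules to $\Gamma$ such that $\ell(0)=0$, $\ell(M_2)=\ell(M_1)+\ell(M_3)$ for every short exact sequence $0\to M_1\to M_2\to M_3\to 0$, and $\ell(M)=\sup\{\ell(N)\mid N\subseteq M \text{ finitely generated submodule}\}$ for every $M$. The sum of an arbitrary family of elements of $\Gamma$ is the supremum of its finite partial sums, and sums of maps from modules to $\Gamma$ are taken pointwise. Let $D$ be a Prüfer domain, i.e. an integral domain such that $D_P$ is a valuation domain for every prime ideal $P$. For a map $\ell$ from $D$-modules to $\Gamma$ let $\ell_{D_P}(M):=\ell(M)$ for every $D_P$-module $M$ (viewed as a $D$-module), and for a map $\ell$ from $D_P$-modules to $\Gamma$ let $\ell^D(M):=\ell(D_P\otimes_D M)$ for every $D$-module $M$. For a prime $P$ of $D$, let $V=D_P$ and $\mathfrak{m}=PD_P$, and for a $V$-module $M$ set: - $t_{\mathfrak m}(M)=0$ if $\mathfrak{m}M=0$ and $M$ is torsion as a $V/\mathfrak{m}$-module (i.e. $M=0$), and $t_{\mathfrak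 m}(M)=\infty$ otherwise; - $i_{\mathfrak m}(M)=0$ if $\mathfrak{m}M=0$, and $i_{\mathfrak m}(M)=\infty$ otherwise; - $\mathrm{rk}_{\mathfrak m}(M)=\mathrm{rank}_{V/\mathfrak m}(M)$ if $\mathfrak{m}M=0$, and $\mathrm{rk}_{\mathfrak m}(M)=\infty$ otherwise; - if there is a largest prime $Q$ properly contained in $P$ (the prime directly below $P$), and $v$ is a rank-one valuation on $D_P/QD_P$ (a real-valued, nontrivial, additive valuation, with $v(0)=\infty$, of the fraction field of $D_P/QD_P$ whose valuation ring is $D_P/QD_P$), pulled back to $V$ along $V\to D_P/QD_P$, $$L_v(M)=\sup\sum_{j=1}^{s}\inf\{v(\alpha)\mid \alpha\in\mathrm{Ann}_V(E_j/E_{j-1})\},$$ the supremum being over all finite chains of submodules $0=E_0\subsetneq E_1\subsetneq\dots\subsetneq E_s=M$. For a length function $\ell$ on $D$ define the following sets of prime ideals of $D$: $$\Sigma_t(\ell)=\{P\mid \ell_{D_P}=t_{PD_P}\},\qquad \Sigma_i(\ell)=\{P\mid \ell_{D_P}=i_{PD_P}\},$$ $$\Sigma_r(\ell)=\{P\mid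 \ell_{D_P}=\alpha\,\mathrm{rk}_{PD_P}\text{ for some real }\alpha>0\},$$ $$\Sigma_v(\ell)=\{P\mid P\text{ has a prime } Q \text{ directly below it and }\ell_{D_P}=L_v\text{ for some rank-one valuation } v\text{ on }D_P/QD_P\}.$$ \textbf{Statement.} Let $D$ be a Prüfer domain such that every ideal of $D$ has only finitely many minimal primes, and let $\ell$ be a length function on $D$. Then there are rank-one valuations $v_P$ on $D_P/QD_P$ (with $Q$ the prime directly below $P$), for $P\in\Sigma_v(\ell)$, such that $\ell_{D_P}=L_{v_P}$ for all $P\in\Sigma_v(\ell)$; and for every such choice, $$\ell=\sum_{P\in\Sigma_t(\ell)}(t_{PD_P})^D+\sum_{P\in\Sigma_i(\ell)}(i_{PD_P})^D+\sum_{P\in\Sigma_r(\ell)}\ell(D/P)\,(\mathrm{rk}_{PD_P})^D+\sum_{P\in\Sigma_v(\ell)}(L_{v_P})^D .$$ -/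

import Mathlib

open scoped ENNReal TensorProduct

universe u

namespace LengthDecomposition

/-- A map assigning to every `R`-module a value in `[0, ∞]`. -/
abbrev ModuleFunction (R : Type u) [CommRing R] : Type (u + 1) :=
  (M : Type u) → [AddCommGroup M] → [Module R M] → ℝ≥0∞

/-- Length functions on `R`: maps from `R`-modules to `[0, ∞]` that vanish on the zero module, are
additive on short exact sequences `0 → M₁ → M₂ → M₃ → 0`, and are upper continuous. (Invariance
under isomorphism follows from the first two conditions.) -/
structure IsLengthFunction {R : Type u} [CommRing R] (ℓ : ModuleFunction R) : Prop where
  zero : ∀ (M : Type u) [AddCommGroup M] [Module R M] [Subsingleton M], ℓ M = 0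
  additive : ∀ (M₁ M₂ M₃ : Type u) [AddCommGroup M₁] [AddCommGroup M₂] [AddCommGroup M₃]
    [Module R M₁] [Module R M₂] [Module R M₃] (f : M₁ →ₗ[R] M₂) (g : M₂ →ₗ[R] M₃),
    Function.Injective f → Function.Exact f g → Function.Surjective g → ℓ M₂ = ℓ M₁ + ℓ M₃
  upperContinuous : ∀ (M : Type u) [AddCommGroup M] [Module R M],
    ℓ M = ⨆ (N : Submodule R M) (_ : N.FG), ℓ N

/-- `ℓ_T`: the value of `ℓ` on a `T`-module, seen as a `D`-module by restriction of scalars. -/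
def restrict {D : Type u} [CommRing D] (T : Type u) [CommRing T] [Algebra D T]
    (ℓ : ModuleFunction D) : ModuleFunction T :=
  fun M _ _ => letI : Module D M := Module.compHom M (algebraMap D T); ℓ M

/-- `ℓ^D`: the map `M ↦ ℓ (T ⊗_D M)` on `D`-modules. -/
def induced (D : Type u) [CommRing D] (T : Type u) [CommRing T] [Algebra D T]
    (ℓ : ModuleFunction T) : ModuleFunction D :=
  fun M _ _ => ℓ (T ⊗[D] M)

section Valuation

variable {V : Type u} [CommRing V]

open Classical in
/-- `t_P`: zero on torsion `V/P`-modules, infinite on all other modules. A `V/P`-module is a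
`V`-module that is annihilated by `P`. -/
noncomputable def torsionSingular (P : Ideal V) : ModuleFunction V :=
  fun M _ _ =>
    if Module.IsTorsionBySet V M P ∧ ∀ m : M, ∃ r : V, r ∉ P ∧ r • m = 0 then 0 else ∞

open Classical in
/-- `i_P`: zero on `V/P`-modules, infinite on all other modules. -/
noncomputable def idempotentSingular (P : Ideal V) : ModuleFunction V :=
  fun M _ _ => if Module.IsTorsionBySet V M P then 0 else ∞

open Classical in
/-- `rk_P`: the rank over `V/P` on `V/P`-modules (infinite ranks of all cardinalities being sent to
`∞`), infinite on all other modules. -/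
noncomputable def rankFunction (P : Ideal V) : ModuleFunction V :=
  fun M _ _ =>
    if h : Module.IsTorsionBySet V M P then
      letI : Module (V ⧸ P) M := h.module
      ((Cardinal.toENat (Module.rank (V ⧸ P) M) : ℕ∞) : ℝ≥0∞)
    else ∞

/-- `L_v`, for `v : V → [0, ∞]`: the supremum, over all finite chains of submodules
`0 = E₀ ⊊ E₁ ⊊ ⋯ ⊊ E_s = M`, of `∑ i, inf {v α | α ∈ Ann (E_i / E_{i-1})}`. -/
noncomputable def valuativeFunction (v : V → ℝ≥0∞) : ModuleFunction V :=
  fun M _ _ =>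
    ⨆ (E : LTSeries (Submodule V M)) (_ : E.head = ⊥) (_ : E.last = ⊤),
      ∑ i : Fin E.length,
        ⨅ α ∈ Module.annihilator V (E i.succ ⧸ (E i.castSucc).submoduleOf (E i.succ)), v α

end Valuation

section Prufer

variable {D : Type u} [CommRing D] [IsDomain D]

/-- A Prüfer domain: every localization at a prime ideal is a valuation domain. -/
def IsPruferDomain (D : Type u) [CommRing D] [IsDomain D] : Prop :=
  ∀ (P : Ideal D) [P.IsPrime], ValuationRing (Localization.AtPrime P)

/-- The local ring `D_P`. -/
abbrev LocAt (P : PrimeSpectrum D) : Type u := Localization.AtPrime P.asIdeal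

/-- The extension `Q D_P` of an ideal `Q` of `D` to `D_P`. -/
abbrev extendIdeal (P : PrimeSpectrum D) (Q : Ideal D) : Ideal (LocAt P) :=
  Q.map (algebraMap D (LocAt P))

/-- A rank-one valuation on `D_P / Q D_P`, where `Q` is the prime ideal directly below `P`, i.e.
the largest prime ideal properly contained in `P` (such a `Q` need not exist).

The valuation is written additively, with real values, and its valuation ring is `D_P / Q D_P`.
It is recorded through its restriction to this ring: there it takes values in `[0, ∞]`, and `x ∣ y`
exactly when `v (y / x) = v y - v x` is nonnegative. -/
structure RankOneValuationAt (P : PrimeSpectrum D) where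
  below : PrimeSpectrum D
  isGreatest_below : IsGreatest {Q : PrimeSpectrum D | Q < P} below
  val : AddValuation (LocAt P ⧸ extendIdeal P below.asIdeal) ℝ≥0∞
  le_iff_dvd : ∀ x y, val x ≤ val y ↔ x ∣ y
  nontrivial : ∃ x, val x ≠ 0 ∧ val x ≠ ∞

/-- The map `D_P → D_P / Q D_P → [0, ∞]` given by a rank-one valuation. -/
noncomputable def RankOneValuationAt.toFun {P : PrimeSpectrum D} (v : RankOneValuationAt P) :
    LocAt P → ℝ≥0∞ :=
  fun x => v.val (Ideal.Quotient.mk _ x)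

/-- `Σ_t(ℓ)`: the primes `P` such that `ℓ_{D_P} = t_{P D_P}`. -/
def sigmaT (ℓ : ModuleFunction D) : Set (PrimeSpectrum D) :=
  {P | restrict (LocAt P) ℓ = torsionSingular (extendIdeal P P.asIdeal)}

/-- `Σ_i(ℓ)`: the primes `P` such that `ℓ_{D_P} = i_{P D_P}`. -/
def sigmaI (ℓ : ModuleFunction D) : Set (PrimeSpectrum D) :=
  {P | restrict (LocAt P) ℓ = idempotentSingular (extendIdeal P P.asIdeal)}

/-- `Σ_r(ℓ)`: the primes `P` such that `ℓ_{D_P} = α · rk_{P D_P}` for some real `α > 0`. -/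
def sigmaR (ℓ : ModuleFunction D) : Set (PrimeSpectrum D) :=
  {P | ∃ α : ℝ≥0∞, α ≠ 0 ∧ α ≠ ∞ ∧ ∀ (M : Type u) [AddCommGroup M] [Module (LocAt P) M],
    restrict (LocAt P) ℓ M = α * rankFunction (extendIdeal P P.asIdeal) M}

/-- `Σ_v(ℓ)`: the primes `P` such that `ℓ_{D_P} = L_v` for some rank-one valuation `v` on
`D_P / Q D_P`, where `Q` is the prime ideal directly below `P`. -/
def sigmaV (ℓ : ModuleFunction D) : Set (PrimeSpectrum D) :=
  {P | ∃ v : RankOneValuationAt P, restrict (LocAt P) ℓ = valuativeFunction v.toFun}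

end Prufer

end LengthDecomposition

open LengthDecomposition

namespace LengthDecomposition

open IsLocalRing

/-! A length function is determined by its values on cyclic modules (`ext_quotient`), and `M ↦ ℓ
(D_P ⊗ M)` and sums of such maps are again length functions. So it suffices to decompose `ℓ (D ⧸
I)`.

If `ℓ (D ⧸ P) = ∞` for some minimal prime `P` of `I`, then `P ∈ Σ_t` and both sides are infinite.
Otherwise the map from `D ⧸ I` to the product of its localizations at the finitely many minimal
primes has kernel and cokernel that are torsion at each of these primes. Over a Prüfer domain the
product of the minimal primes kills such modules, so `ℓ` vanishes on them, and `ℓ (D ⧸ I)` is the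
sum of the local terms (`eq_sum_minimalPrimes`).

At a minimal prime `P` the annihilator of `(D ⧸ I)_P` has radical `P D_P`. The `trichotomy` for
valuation domains then says that a nonzero term puts `P` in one of the four supports
(`mem_pureSupport`). Conversely, no prime properly above a `Q` with `ℓ (D ⧸ Q) < ∞` lies in any
support (`notMem_of_lt`), so no further terms appear. Overlaps between supports are harmless: `Σ_r`
and `Σ_v` are disjoint, and terms from `Σ_t` or `Σ_i` are `0` or `∞`. -/

theorem exists_span_singleton_quotient_eq_top {R M : Type*} [CommRing R] [AddCommGroup M]
    [Module R M] (S : Set M) (a : M) :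
    ∃ b : (Submodule.span R (insert a S) : Submodule R M) ⧸
        (Submodule.span R S).submoduleOf (Submodule.span R (insert a S)),
      Submodule.span R {b} = ⊤ := by
  set T := Submodule.span R (insert a S)
  set K := (Submodule.span R S).submoduleOf T
  refine ⟨K.mkQ ⟨a, Submodule.subset_span (Set.mem_insert _ _)⟩, ?_⟩
  rw [eq_top_iff]
  rintro y -
  obtain ⟨⟨y, hy⟩, rfl⟩ := K.mkQ_surjective y
  obtain ⟨c, z, hz, rfl⟩ := Submodule.mem_span_insert.1 hy
  refine Submodule.mem_span_singleton.2 ⟨c, ?_⟩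
  rw [← map_smul, Submodule.mkQ_apply, Submodule.mkQ_apply, Submodule.Quotient.eq]
  change _ ∈ Submodule.span R S
  simpa using hz

/-! ### Formal properties of length functions -/

namespace IsLengthFunction

variable {R : Type u} [CommRing R] {ℓ : ModuleFunction R}
  {M N : Type u} [AddCommGroup M] [AddCommGroup N] [Module R M] [Module R N]

theorem congr (hℓ : IsLengthFunction ℓ) (e : M ≃ₗ[R] N) : ℓ M = ℓ N := by
  have h := hℓ.additive M N PUnit e.toLinearMap 0 e.injective
    (fun y ↦ ⟨fun _ ↦ e.surjective y, fun _ ↦ rfl⟩) (fun y ↦ ⟨0, Subsingleton.elim _ _⟩)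
  rw [h, hℓ.zero PUnit, add_zero]

theorem eq_add_quotient (hℓ : IsLengthFunction ℓ) (K : Submodule R M) :
    ℓ M = ℓ K + ℓ (M ⧸ K) :=
  hℓ.additive K M (M ⧸ K) K.subtype K.mkQ K.injective_subtype
    (LinearMap.exact_subtype_mkQ K) K.mkQ_surjective

theorem le_of_injective (hℓ : IsLengthFunction ℓ) (f : M →ₗ[R] N)
    (hf : Function.Injective f) : ℓ M ≤ ℓ N := by
  rw [hℓ.congr (LinearEquiv.ofInjective f hf), hℓ.eq_add_quotient (LinearMap.range f)]
  exact le_self_add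

theorem le_of_surjective (hℓ : IsLengthFunction ℓ) (f : M →ₗ[R] N)
    (hf : Function.Surjective f) : ℓ N ≤ ℓ M := by
  rw [hℓ.eq_add_quotient (LinearMap.ker f), hℓ.congr (f.quotKerEquivOfSurjective hf)]
  exact le_add_self

theorem le_of_le (hℓ : IsLengthFunction ℓ) {K L : Submodule R M} (h : K ≤ L) : ℓ K ≤ ℓ L :=
  hℓ.le_of_injective (Submodule.inclusion h) (Submodule.inclusion_injective h)

theorem quotient_le_of_le (hℓ : IsLengthFunction ℓ) {K L : Submodule R M} (h : K ≤ L) :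
    ℓ (M ⧸ L) ≤ ℓ (M ⧸ K) :=
  hℓ.le_of_surjective (Submodule.factor h) (Submodule.factor_surjective h)

theorem eq_ker_add_range (hℓ : IsLengthFunction ℓ) (f : M →ₗ[R] N) :
    ℓ M = ℓ (LinearMap.ker f) + ℓ (LinearMap.range f) := by
  rw [hℓ.eq_add_quotient (LinearMap.ker f), hℓ.congr f.quotKerEquivRange]

theorem eq_of_ker_of_coker (hℓ : IsLengthFunction ℓ) (f : M →ₗ[R] N)
    (hk : ℓ (LinearMap.ker f) = 0) (hc : ℓ (N ⧸ LinearMap.range f) = 0) : ℓ M = ℓ N := by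
  rw [hℓ.eq_ker_add_range f, hk, hℓ.eq_add_quotient (LinearMap.range f), hc, zero_add, add_zero]

theorem prod (hℓ : IsLengthFunction ℓ) : ℓ (M × N) = ℓ M + ℓ N :=
  hℓ.additive M (M × N) N (LinearMap.inl R M N) (LinearMap.snd R M N)
    LinearMap.inl_injective Function.Exact.inl_snd LinearMap.snd_surjective

theorem pi (hℓ : IsLengthFunction ℓ) (ι : Type u) [Fintype ι] :
    ∀ (X : ι → Type u) [∀ i, AddCommGroup (X i)] [∀ i, Module R (X i)],
      ℓ (∀ i, X i) = ∑ i, ℓ (X i) := by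
  refine Fintype.induction_empty_option (P := fun ι _ ↦ ∀ (X : ι → Type u)
    [∀ i, AddCommGroup (X i)] [∀ i, Module R (X i)], ℓ (∀ i, X i) = ∑ i, ℓ (X i)) ?_ ?_ ?_ ι
  · intro α β _ e h X _ _
    let := Fintype.ofEquiv β e.symm
    rw [← hℓ.congr (LinearEquiv.piCongrLeft R X e), h, ← Equiv.sum_comp e]
  · intro X _ _
    simpa using hℓ.zero (∀ i, X i)
  · intro α _ h X _ _
    rw [hℓ.congr (LinearEquiv.piOptionEquivProd R (M := X)), hℓ.prod, h, Fintype.sum_option]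

theorem sup_le (hℓ : IsLengthFunction ℓ) (K L : Submodule R M) :
    ℓ (K ⊔ L : Submodule R M) ≤ ℓ K + ℓ L := by
  have h := hℓ.le_of_surjective (N := LinearMap.range (K.subtype.coprod L.subtype))
    (K.subtype.coprod L.subtype).rangeRestrict (LinearMap.surjective_rangeRestrict _)
  rw [hℓ.prod] at h
  have e : LinearMap.range (K.subtype.coprod L.subtype) = K ⊔ L := by
    rw [LinearMap.range_coprod, Submodule.range_subtype, Submodule.range_subtype]
  rwa [e] at h

theorem span_singleton (hℓ : IsLengthFunction ℓ) (x : M) :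
    ℓ (Submodule.span R {x}) = ℓ (R ⧸ Ideal.torsionOf R M x) :=
  (hℓ.congr (Ideal.quotTorsionOfEquivSpanSingleton R M x)).symm

theorem quotient_torsionOf_le (hℓ : IsLengthFunction ℓ) (x : M) :
    ℓ (R ⧸ Ideal.torsionOf R M x) ≤ ℓ M := by
  rw [← hℓ.span_singleton]
  exact hℓ.le_of_injective _ (Submodule.injective_subtype _)

theorem eq_zero_of_span_singleton (hℓ : IsLengthFunction ℓ)
    (h : ∀ x : M, ℓ (Submodule.span R {x}) = 0) : ℓ M = 0 := by
  rw [hℓ.upperContinuous M]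
  simp only [ENNReal.iSup_eq_zero]
  intro N hN
  induction N, hN using Submodule.fg_induction with
  | singleton x => exact h x
  | sup K L _ _ hK hL => exact le_antisymm ((hℓ.sup_le K L).trans (by simp [hK, hL])) bot_le

/-- Length functions that agree on cyclic modules are equal. -/
theorem ext_quotient (hℓ : IsLengthFunction ℓ) {κ : ModuleFunction R} (hκ : IsLengthFunction κ)
    (h : ∀ I : Ideal R, ℓ (R ⧸ I) = κ (R ⧸ I)) (M : Type u) [AddCommGroup M] [Module R M] :
    ℓ M = κ M := by
  have key : ∀ (S : Finset M), ℓ (Submodule.span R (S : Set M)) =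
      κ (Submodule.span R (S : Set M)) := by
    classical
    intro S
    induction S using Finset.induction_on with
    | empty =>
      rw [Finset.coe_empty, Submodule.span_empty, hℓ.zero, hκ.zero]
    | insert a S _ ih =>
      rw [Finset.coe_insert]
      set T := Submodule.span R (insert a (S : Set M)) with hT
      have hST : Submodule.span R (S : Set M) ≤ T := Submodule.span_mono (Set.subset_insert _ _)
      set K := (Submodule.span R (S : Set M)).submoduleOf T
      have e := Submodule.submoduleOfEquivOfLe hST
      obtain ⟨b, hb⟩ := exists_span_singleton_quotient_eq_top (R := R) (S : Set M) a
      have e' := (Ideal.quotTorsionOfEquivSpanSingleton R _ b).trans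
        ((LinearEquiv.ofEq _ _ hb).trans Submodule.topEquiv)
      rw [hℓ.eq_add_quotient K, hκ.eq_add_quotient K, hℓ.congr e, hκ.congr e, ih,
        ← hℓ.congr e', ← hκ.congr e', h]
  rw [hℓ.upperContinuous, hκ.upperContinuous]
  refine iSup_congr fun N ↦ iSup_congr fun hN ↦ ?_
  obtain ⟨S, rfl⟩ := hN
  exact key S

/-- If `ℓ (R / P)` is finite, then `ℓ` vanishes on torsion `R / P`-modules. -/
theorem eq_zero_of_torsion (hℓ : IsLengthFunction ℓ) {P : Ideal R} [P.IsPrime]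
    (hP : ℓ (R ⧸ P) ≠ ∞) (h : Module.IsTorsionBySet R M P)
    (ht : ∀ x : M, ∃ r ∉ P, r • x = 0) : ℓ M = 0 := by
  refine hℓ.eq_zero_of_span_singleton fun x ↦ ?_
  obtain ⟨r, hr, hx⟩ := ht x
  -- Multiplication by `r` is injective on `R ⧸ P`, so its image has full length. That length is
  -- finite, so the cokernel has length zero, and `Rx` is a quotient of the cokernel.
  let f : (R ⧸ P) →ₗ[R] (R ⧸ P) := LinearMap.lsmul R (R ⧸ P) r
  have hf : LinearMap.ker f = ⊥ := by
    rw [LinearMap.ker_eq_bot']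
    intro y hy
    obtain ⟨y, rfl⟩ := Ideal.Quotient.mk_surjective y
    have : Ideal.Quotient.mk P (r * y) = 0 := hy
    rw [Ideal.Quotient.eq_zero_iff_mem] at this ⊢
    exact (Ideal.IsPrime.mem_or_mem ‹_› this).resolve_left hr
  have h1 := hℓ.eq_ker_add_range f
  have h2 := hℓ.eq_add_quotient (LinearMap.range f)
  rw [hf, hℓ.zero (⊥ : Submodule R (R ⧸ P)), zero_add] at h1
  have h3 : ℓ ((R ⧸ P) ⧸ LinearMap.range f) = 0 := by
    rw [h1] at hP
    rw [h1] at h2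
    exact (ENNReal.add_right_inj hP).1 (by rw [← h2, add_zero])
  let g : R →ₗ[R] M := LinearMap.toSpanSingleton R M x
  let g₁ : (R ⧸ P) →ₗ[R] M := Submodule.liftQ P g (fun p hp ↦ @h x ⟨p, hp⟩)
  let g₂ : ((R ⧸ P) ⧸ LinearMap.range f) →ₗ[R] M := Submodule.liftQ _ g₁ (by
    rintro _ ⟨y, rfl⟩
    obtain ⟨y, rfl⟩ := Ideal.Quotient.mk_surjective y
    change (r * y) • x = 0
    rw [mul_comm, mul_smul, hx, smul_zero])
  have h4 : Submodule.span R {x} = LinearMap.range g₂ := by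
    rw [Submodule.range_liftQ, ← LinearMap.range_toSpanSingleton]
    exact (Submodule.range_liftQ P g _).symm
  rw [h4]
  exact le_antisymm ((hℓ.le_of_surjective _ g₂.surjective_rangeRestrict).trans h3.le) bot_le

end IsLengthFunction

/-! ### Restriction of scalars, flat base change and sums -/

section Restrict

variable {D : Type u} [CommRing D] {T : Type u} [CommRing T] [Algebra D T] {ℓ : ModuleFunction D}

theorem restrict_eq (ℓ : ModuleFunction D) (M : Type u) [AddCommGroup M] [Module T M]
    [i : Module D M] [IsScalarTower D T M] : restrict T ℓ M = ℓ M := by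
  have : Module.compHom M (algebraMap D T) = i := by
    refine Module.ext' _ _ fun r x ↦ ?_
    exact algebraMap_smul T r x
  unfold restrict
  rw [this]

theorem IsLengthFunction.restrict (hℓ : IsLengthFunction ℓ) :
    IsLengthFunction (restrict T ℓ) where
  zero M _ _ _ := by
    let := Module.compHom M (algebraMap D T)
    exact hℓ.zero M
  additive M₁ M₂ M₃ _ _ _ _ _ _ f g hf hfg hg := by
    let := Module.compHom M₁ (algebraMap D T)
    let := Module.compHom M₂ (algebraMap D T)
    let := Module.compHom M₃ (algebraMap D T)
    have : IsScalarTower D T M₁ := .of_algebraMap_smul fun _ _ ↦ rfl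
    have : IsScalarTower D T M₂ := .of_algebraMap_smul fun _ _ ↦ rfl
    have : IsScalarTower D T M₃ := .of_algebraMap_smul fun _ _ ↦ rfl
    exact hℓ.additive M₁ M₂ M₃ (f.restrictScalars D) (g.restrictScalars D) hf hfg hg
  upperContinuous M _ _ := by
    let := Module.compHom M (algebraMap D T)
    have : IsScalarTower D T M := .of_algebraMap_smul fun _ _ ↦ rfl
    have e (N : Submodule T M) : LengthDecomposition.restrict T ℓ N = ℓ (N.restrictScalars D) :=
      restrict_eq ℓ N
    rw [restrict_eq ℓ M]
    simp only [e]
    apply le_antisymm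
    · rw [hℓ.upperContinuous M]
      refine iSup₂_le fun N hN ↦ ?_
      obtain ⟨S, rfl⟩ := hN
      refine le_iSup₂_of_le (Submodule.span T (S : Set M)) ⟨S, rfl⟩ ?_
      exact hℓ.le_of_le (Submodule.span_le_restrictScalars D T _)
    · exact iSup₂_le fun N _ ↦ hℓ.le_of_injective _ (N.restrictScalars D).injective_subtype

theorem induced_restrict_eq (ℓ : ModuleFunction D) (M : Type u) [AddCommGroup M] [Module D M] :
    induced D T (restrict T ℓ) M = ℓ (T ⊗[D] M) :=
  restrict_eq ℓ (T ⊗[D] M)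

variable (T) in
-- Flatness gives additivity. For continuity, finitely many elements of `T ⊗ M` involve finitely
-- many elements of `M`, hence come from `T ⊗ K` with `K` finitely generated.
theorem IsLengthFunction.baseChange [Module.Flat D T] (hℓ : IsLengthFunction ℓ) :
    IsLengthFunction (fun M [AddCommGroup M] [Module D M] ↦ ℓ (T ⊗[D] M)) where
  zero M _ _ _ := hℓ.zero _
  additive M₁ M₂ M₃ _ _ _ _ _ _ f g hf hfg hg :=
    hℓ.additive _ _ _ (f.lTensor T) (g.lTensor T) (Module.Flat.lTensor_preserves_injective_linearMap f hf)
      (lTensor_exact T hfg hg) (LinearMap.lTensor_surjective T hg)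
  upperContinuous M _ _ := by
    have mono {K L : Submodule D M} (h : K ≤ L) : LinearMap.range (K.subtype.lTensor T) ≤
        LinearMap.range (L.subtype.lTensor T) := by
      rw [← Submodule.subtype_comp_inclusion K L h, LinearMap.lTensor_comp]
      exact LinearMap.range_comp_le_range _ _
    apply le_antisymm
    · rw [hℓ.upperContinuous]
      refine iSup₂_le fun N hN ↦ ?_
      obtain ⟨K, hK, hNK⟩ : ∃ K : Submodule D M, K.FG ∧
          N ≤ LinearMap.range (K.subtype.lTensor T) := by
        induction N, hN using Submodule.fg_induction with
        | singleton x =>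
          induction x using TensorProduct.induction_on with
          | zero => exact ⟨⊥, Submodule.fg_bot, by simp⟩
          | tmul t m =>
            refine ⟨Submodule.span D {m}, Submodule.fg_span_singleton m, ?_⟩
            rw [Submodule.span_singleton_le_iff_mem]
            exact ⟨t ⊗ₜ ⟨m, Submodule.mem_span_singleton_self m⟩, rfl⟩
          | add x y hx hy =>
            obtain ⟨K, hK, hx⟩ := hx
            obtain ⟨L, hL, hy⟩ := hy
            refine ⟨K ⊔ L, hK.sup hL, ?_⟩
            rw [Submodule.span_singleton_le_iff_mem] at *
            exact add_mem (mono le_sup_left hx) (mono le_sup_right hy)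
        | sup A B _ _ hA hB =>
          obtain ⟨K, hK, hx⟩ := hA
          obtain ⟨L, hL, hy⟩ := hB
          refine ⟨K ⊔ L, hK.sup hL, ?_⟩
          exact _root_.sup_le (hx.trans (mono le_sup_left)) (hy.trans (mono le_sup_right))
      refine le_iSup₂_of_le K hK ?_
      refine (hℓ.le_of_le hNK).trans ?_
      exact hℓ.le_of_surjective _ (K.subtype.lTensor T).surjective_rangeRestrict
    · exact iSup₂_le fun N _ ↦ hℓ.le_of_injective (N.subtype.lTensor T)
        (Module.Flat.lTensor_preserves_injective_linearMap _ N.injective_subtype)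

end Restrict

theorem IsLengthFunction.tsum {R : Type u} [CommRing R] {ι : Type*} {κ : ι → ModuleFunction R}
    (h : ∀ i, IsLengthFunction (κ i)) :
    IsLengthFunction (fun M [AddCommGroup M] [Module R M] ↦ ∑' i, κ i M) where
  zero M _ _ _ := by simp [(h _).zero M]
  additive M₁ M₂ M₃ _ _ _ _ _ _ f g hf hfg hg := by
    rw [← ENNReal.tsum_add]
    exact tsum_congr fun i ↦ (h i).additive _ _ _ f g hf hfg hg
  upperContinuous M _ _ := by
    have e (i) : κ i M = ⨆ N : {N : Submodule R M // N.FG}, κ i N.1 := by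
      rw [(h i).upperContinuous M, iSup_subtype]
    simp only [e, ENNReal.tsum_eq_iSup_sum]
    rw [iSup_subtype', iSup_comm]
    refine iSup_congr fun s ↦ ?_
    -- Finitely generated submodules are directed, so the supremum commutes with finite sums.
    refine ENNReal.finsetSum_iSup fun K L ↦ ⟨⟨K.1 ⊔ L.1, K.2.sup L.2⟩, fun i ↦ ⟨?_, ?_⟩⟩
    · exact (h i).le_of_le le_sup_left
    · exact (h i).le_of_le le_sup_right

namespace IsLengthFunction

/-! ### Local rings: the types `t`, `i` and `rk` -/

section Local

variable {V : Type u} [CommRing V] [IsLocalRing V] {ℓ : ModuleFunction V}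

theorem torsionOf_le_maximalIdeal {M : Type*} [AddCommGroup M] [Module V M] {x : M} (hx : x ≠ 0) :
    Ideal.torsionOf V M x ≤ maximalIdeal V :=
  le_maximalIdeal fun h ↦ hx ((Ideal.torsionOf_eq_top_iff V x).1 h)

/-- Every nonzero module contains a nonzero cyclic one, which surjects onto the residue field. -/
theorem eq_torsionSingular (hℓ : IsLengthFunction ℓ) (h : ℓ (V ⧸ maximalIdeal V) = ∞) :
    ℓ = torsionSingular (maximalIdeal V) := by
  funext M _ _
  unfold torsionSingular
  rcases subsingleton_or_nontrivial M with hM | hM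
  · rw [hℓ.zero M, if_pos]
    exact ⟨fun _ _ ↦ Subsingleton.elim _ _, fun m ↦ ⟨1, by simp, Subsingleton.elim _ _⟩⟩
  · obtain ⟨x, hx⟩ := exists_ne (0 : M)
    rw [if_neg]
    · rw [eq_top_iff]
      refine le_trans ?_ (hℓ.quotient_torsionOf_le x)
      rw [← h]
      exact hℓ.quotient_le_of_le (torsionOf_le_maximalIdeal hx)
    · rintro ⟨-, h⟩
      obtain ⟨r, hr, hrx⟩ := h x
      exact hr (torsionOf_le_maximalIdeal hx hrx)

theorem eq_top_of_not_isTorsionBySet (hℓ : IsLengthFunction ℓ)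
    (h : ∀ J < maximalIdeal V, ℓ (V ⧸ J) = ∞) {M : Type u} [AddCommGroup M] [Module V M]
    (hM : ¬ Module.IsTorsionBySet V M (maximalIdeal V)) : ℓ M = ∞ := by
  unfold Module.IsTorsionBySet at hM
  push Not at hM
  obtain ⟨x, ⟨a, ha⟩, hx⟩ := hM
  have hx' : x ≠ 0 := by rintro rfl; simp at hx
  rw [eq_top_iff, ← h _ (lt_of_le_of_ne (torsionOf_le_maximalIdeal hx') ?_)]
  · exact hℓ.quotient_torsionOf_le x
  · intro e
    have ha' : a ∈ Ideal.torsionOf V M x := e ▸ ha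
    exact hx ha'

theorem eq_idempotentSingular (hℓ : IsLengthFunction ℓ)
    (h : ∀ J < maximalIdeal V, ℓ (V ⧸ J) = ∞) (h0 : ℓ (V ⧸ maximalIdeal V) = 0) :
    ℓ = idempotentSingular (maximalIdeal V) := by
  funext M _ _
  unfold idempotentSingular
  split_ifs with hM
  · refine hℓ.eq_zero_of_span_singleton fun x ↦ ?_
    rw [hℓ.span_singleton, ← nonpos_iff_eq_zero, ← h0]
    exact hℓ.quotient_le_of_le fun a ha ↦ @hM x ⟨a, ha⟩
  · exact hℓ.eq_top_of_not_isTorsionBySet h hM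

theorem eq_mul_rankFunction (hℓ : IsLengthFunction ℓ)
    (h : ∀ J < maximalIdeal V, ℓ (V ⧸ J) = ∞) (h0 : ℓ (V ⧸ maximalIdeal V) ≠ 0)
    (M : Type u) [AddCommGroup M] [Module V M] :
    ℓ M = ℓ (V ⧸ maximalIdeal V) * rankFunction (maximalIdeal V) M := by
  unfold rankFunction
  split_ifs with hM
  · let : Module (V ⧸ maximalIdeal V) M := hM.module
    have : IsScalarTower V (V ⧸ maximalIdeal V) M := hM.isScalarTower
    let := Ideal.Quotient.field (maximalIdeal V)
    let b := Module.Free.chooseBasis (V ⧸ maximalIdeal V) M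
    rw [← b.mk_eq_rank'']
    -- Finite parts of a basis bound `ℓ M` from below, which settles infinite rank of any
    -- cardinality.
    have key (s : Finset (Module.Free.ChooseBasisIndex (V ⧸ maximalIdeal V) M)) :
        s.card * ℓ (V ⧸ maximalIdeal V) ≤ ℓ M := by
      have := hℓ.le_of_injective ((Fintype.linearCombination (V ⧸ maximalIdeal V)
        (fun i : s ↦ b i)).restrictScalars V)
        (b.linearIndependent.comp _ Subtype.val_injective).fintypeLinearCombination_injective
      rw [hℓ.pi] at this
      simpa using this
    cases finite_or_infinite (Module.Free.ChooseBasisIndex (V ⧸ maximalIdeal V) M) with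
    | inl hfin =>
      let := Fintype.ofFinite (Module.Free.ChooseBasisIndex (V ⧸ maximalIdeal V) M)
      rw [hℓ.congr (b.equivFun.restrictScalars V), hℓ.pi]
      simp [mul_comm]
    | inr hinf =>
      rw [Cardinal.toENat_eq_top.2 (Cardinal.aleph0_le_mk _), ENat.toENNReal_top,
        ENNReal.mul_top h0, eq_top_iff]
      refine ENNReal.le_of_forall_nnreal_lt fun r _ ↦ ?_
      obtain ⟨n, hn⟩ := ENNReal.exists_nat_mul_gt h0 (ENNReal.coe_ne_top (r := r))
      obtain ⟨s, hs⟩ := Infinite.exists_subset_card_eq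
        (Module.Free.ChooseBasisIndex (V ⧸ maximalIdeal V) M) n
      exact hn.le.trans (hs ▸ key s)
  · rw [ENNReal.mul_top h0, hℓ.eq_top_of_not_isTorsionBySet h hM]

end Local

/-! ### Domains: the valuation `y ↦ ℓ (V / yV)` -/

section Domain

variable {V : Type u} [CommRing V] {ℓ : ModuleFunction V}

theorem quotient_span_one (hℓ : IsLengthFunction ℓ) : ℓ (V ⧸ Ideal.span {(1 : V)}) = 0 := by
  have : Subsingleton (V ⧸ Ideal.span {(1 : V)}) := by
    rw [Ideal.span_singleton_one]; infer_instance
  exact hℓ.zero _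

theorem quotient_span_le_of_dvd (hℓ : IsLengthFunction ℓ) {x y : V} (h : x ∣ y) :
    ℓ (V ⧸ Ideal.span {x}) ≤ ℓ (V ⧸ Ideal.span {y}) :=
  hℓ.quotient_le_of_le (Ideal.span_singleton_le_span_singleton.2 h)

variable [IsDomain V]

/-- Multiplication by `y` gives the exact sequence `0 → V/J → V/yJ → V/yV → 0`. -/
theorem quotient_span_singleton_mul (hℓ : IsLengthFunction ℓ) {y : V} (hy : y ≠ 0) (J : Ideal V) :
    ℓ (V ⧸ Ideal.span {y} * J) = ℓ (V ⧸ Ideal.span {y}) + ℓ (V ⧸ J) := by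
  have hle : J ≤ Submodule.comap (LinearMap.lsmul V V y) (Ideal.span {y} * J) := fun a ha ↦
    Ideal.mul_mem_mul (Ideal.mem_span_singleton_self y) ha
  rw [add_comm]
  refine hℓ.additive (V ⧸ J) _ _
    (Submodule.mapQ J (Ideal.span {y} * J) (LinearMap.lsmul V V y) hle)
    (Submodule.factor Ideal.mul_le_left) ?_ ?_ (Submodule.factor_surjective _)
  · rw [← LinearMap.ker_eq_bot, LinearMap.ker_eq_bot']
    intro a ha
    obtain ⟨a, rfl⟩ := Ideal.Quotient.mk_surjective a
    have : Ideal.Quotient.mk _ (y * a) = 0 := ha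
    rw [Ideal.Quotient.eq_zero_iff_mem, Ideal.mem_span_singleton_mul] at this
    obtain ⟨z, hz, e⟩ := this
    rw [Ideal.Quotient.eq_zero_iff_mem, ← mul_left_cancel₀ hy e]
    exact hz
  · intro a
    obtain ⟨a, rfl⟩ := Ideal.Quotient.mk_surjective a
    constructor
    · intro ha
      have : Ideal.Quotient.mk (Ideal.span {y}) a = 0 := ha
      rw [Ideal.Quotient.eq_zero_iff_mem, Ideal.mem_span_singleton] at this
      obtain ⟨c, rfl⟩ := this
      exact ⟨Ideal.Quotient.mk J c, rfl⟩
    · rintro ⟨c, hc⟩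
      obtain ⟨c, rfl⟩ := Ideal.Quotient.mk_surjective c
      rw [← hc]
      change Ideal.Quotient.mk (Ideal.span {y}) (y * c) = 0
      rw [Ideal.Quotient.eq_zero_iff_mem]
      exact Ideal.mul_mem_right _ _ (Ideal.mem_span_singleton_self y)

theorem quotient_span_mul (hℓ : IsLengthFunction ℓ) {y : V} (hy : y ≠ 0) (w : V) :
    ℓ (V ⧸ Ideal.span {y * w}) = ℓ (V ⧸ Ideal.span {y}) + ℓ (V ⧸ Ideal.span {w}) := by
  rw [← hℓ.quotient_span_singleton_mul hy, Ideal.span_singleton_mul_span_singleton]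

theorem quotient_span_pow (hℓ : IsLengthFunction ℓ) {y : V} (hy : y ≠ 0) (n : ℕ) :
    ℓ (V ⧸ Ideal.span {y ^ n}) = n * ℓ (V ⧸ Ideal.span {y}) := by
  induction n with
  | zero => rw [pow_zero, hℓ.quotient_span_one, Nat.cast_zero, zero_mul]
  | succ n ih => rw [pow_succ, hℓ.quotient_span_mul (pow_ne_zero _ hy), ih]; push_cast; ring

/-- The valuation `y ↦ ℓ (V / yV)`. -/
noncomputable def addValuation [ValuationRing V] (hℓ : IsLengthFunction ℓ)
    (h0 : ℓ (V ⧸ Ideal.span {(0 : V)}) = ∞) : AddValuation V ℝ≥0∞ :=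
  AddValuation.of (fun y ↦ ℓ (V ⧸ Ideal.span {y})) h0 hℓ.quotient_span_one
    (fun x y ↦ by
      rcases ValuationRing.dvd_total x y with h | h
      · exact (min_le_left _ _).trans (hℓ.quotient_span_le_of_dvd (dvd_add dvd_rfl h))
      · exact (min_le_right _ _).trans (hℓ.quotient_span_le_of_dvd (dvd_add h dvd_rfl)))
    (fun x y ↦ by
      rcases eq_or_ne x 0 with rfl | hx
      · rw [zero_mul, h0, top_add]
      · exact hℓ.quotient_span_mul hx y)

end Domain

end IsLengthFunction

/-! ### Valuation domains: the type `L_v` and the trichotomy -/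

theorem last_eq_add_sum {n : ℕ} (g : Fin (n + 1) → ℝ≥0∞) (d : Fin n → ℝ≥0∞)
    (h : ∀ i : Fin n, g i.succ = g i.castSucc + d i) : g (Fin.last n) = g 0 + ∑ i, d i := by
  induction n with
  | zero => simp
  | succ n ih =>
    rw [Fin.sum_univ_castSucc, ← add_assoc, ← Fin.succ_last, h,
      ih (fun i ↦ g i.castSucc) (fun i ↦ d i.castSucc) fun i ↦ by rw [← h, Fin.succ_castSucc],
      Fin.castSucc_zero]

namespace IsLengthFunction

variable {V : Type u} [CommRing V] {ℓ : ModuleFunction V}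

theorem ne_zero_of_quotient_ne_top (h0 : ℓ (V ⧸ Ideal.span {(0 : V)}) = ∞)
    {x : V} (hx : ℓ (V ⧸ Ideal.span {x}) ≠ ∞) : x ≠ 0 := by
  rintro rfl
  exact hx h0

/-- Adding generators one at a time gives cyclic factors `V/J`, and any `α` killing `V/J` satisfies
`αV ≤ J`, so `ℓ (V/J) ≤ ℓ (V/αV)`. -/
theorem exists_chain_le (hℓ : IsLengthFunction ℓ) (M : Type u) [AddCommGroup M] [Module V M]
    (S : Finset M) :
    ∃ (n : ℕ) (g : Fin (n + 1) → Submodule V M), (∀ i : Fin n, g i.castSucc < g i.succ) ∧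
      g 0 = ⊥ ∧ g (Fin.last n) = Submodule.span V (S : Set M) ∧
      ℓ (Submodule.span V (S : Set M)) ≤ ∑ i : Fin n,
        ⨅ α ∈ Module.annihilator V (g i.succ ⧸ (g i.castSucc).submoduleOf (g i.succ)),
          ℓ (V ⧸ Ideal.span {α}) := by
  classical
  induction S using Finset.induction_on with
  | empty =>
    refine ⟨0, fun _ ↦ ⊥, fun i ↦ i.elim0, rfl, by simp, ?_⟩
    rw [Finset.coe_empty, Submodule.span_empty, hℓ.zero]
    exact bot_le
  | insert a S _ ih =>
    obtain ⟨n, g, hg, hg0, hgl, hle⟩ := ih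
    rw [Finset.coe_insert]
    -- Redundant generators are skipped, since the chain must be strict.
    by_cases ha : a ∈ Submodule.span V (S : Set M)
    · rw [Submodule.span_insert_eq_span ha]
      exact ⟨n, g, hg, hg0, hgl, hle⟩
    · set T := Submodule.span V (insert a (S : Set M)) with hT
      have haT : a ∈ T := Submodule.subset_span (Set.mem_insert _ _)
      have hST : Submodule.span V (S : Set M) ≤ T := Submodule.span_mono (Set.subset_insert _ _)
      refine ⟨n + 1, Fin.snoc (α := fun _ ↦ Submodule V M) g T, ?_, ?_, ?_, ?_⟩
      · intro i
        cases i using Fin.lastCases with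
        | last =>
          rw [Fin.succ_last, Fin.snoc_last, Fin.snoc_castSucc, hgl]
          exact lt_of_le_of_ne hST fun e ↦ ha (e ▸ haT)
        | cast i =>
          rw [Fin.succ_castSucc, Fin.snoc_castSucc, Fin.snoc_castSucc]
          exact hg i
      · rw [← Fin.castSucc_zero, Fin.snoc_castSucc, hg0]
      · rw [Fin.snoc_last]
      · obtain ⟨b, hb⟩ := exists_span_singleton_quotient_eq_top (R := V) (S : Set M) a
        rw [Fin.sum_univ_castSucc, hℓ.eq_add_quotient ((Submodule.span V (S : Set M)).submoduleOf T)]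
        refine add_le_add ?_ ?_
        · rw [hℓ.congr (Submodule.submoduleOfEquivOfLe hST)]
          refine hle.trans (Finset.sum_le_sum fun i _ ↦ ?_)
          rw [Fin.succ_castSucc, Fin.snoc_castSucc, Fin.snoc_castSucc]
        · rw [Fin.succ_last, Fin.snoc_last, Fin.snoc_castSucc, hgl]
          refine le_iInf₂ fun α hα ↦ ?_
          rw [← hℓ.congr (Submodule.topEquiv (R := V)), ← hb, hℓ.span_singleton]
          refine hℓ.quotient_le_of_le ?_
          rw [Ideal.span_singleton_le_iff_mem, Ideal.mem_torsionOf_iff]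
          exact Module.mem_annihilator.1 hα b

variable [IsDomain V] [ValuationRing V]

/-- A generator of a principal maximal ideal works. Otherwise every nonzero nonunit of finite value
is a product of two nonunits, one of which has at most half the value, so repeated halving reaches
below `ε`. -/
theorem exists_quotient_span_le (hℓ : IsLengthFunction ℓ)
    (h0 : ℓ (V ⧸ Ideal.span {(0 : V)}) = ∞) {x : V} (hx : x ∈ maximalIdeal V)
    (hxt : ℓ (V ⧸ Ideal.span {x}) ≠ ∞) {ε : ℝ≥0∞} (hε : ε ≠ 0) :
    ∃ z ∈ maximalIdeal V, ℓ (V ⧸ Ideal.span {z}) ≠ ∞ ∧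
      ℓ (V ⧸ Ideal.span {z}) ≤ ℓ (V ⧸ maximalIdeal V) + ε := by
  by_cases hm : ∃ p, maximalIdeal V = Ideal.span {p}
  · obtain ⟨p, hp⟩ := hm
    rw [hp] at hx ⊢
    refine ⟨p, Ideal.mem_span_singleton_self p, ?_, le_self_add⟩
    exact ne_top_of_le_ne_top hxt
      (hℓ.quotient_span_le_of_dvd (Ideal.mem_span_singleton.1 hx))
  · push Not at hm
    have key (n : ℕ) : ∃ z ∈ maximalIdeal V,
        2 ^ n * ℓ (V ⧸ Ideal.span {z}) ≤ ℓ (V ⧸ Ideal.span {x}) := by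
      induction n with
      | zero => exact ⟨x, hx, by simp⟩
      | succ n ih =>
        obtain ⟨z, hz, hzx⟩ := ih
        have hzt : ℓ (V ⧸ Ideal.span {z}) ≠ ∞ := by
          intro h
          rw [h, ENNReal.mul_top (by simp)] at hzx
          exact hxt (top_le_iff.1 hzx)
        have hz0 := ne_zero_of_quotient_ne_top h0 hzt
        have hlt : Ideal.span {z} < maximalIdeal V :=
          lt_of_le_of_ne ((Ideal.span_singleton_le_iff_mem _).2 hz) (hm z).symm
        obtain ⟨y, hy, hyz⟩ := SetLike.exists_of_lt hlt
        rw [Ideal.mem_span_singleton] at hyz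
        obtain ⟨w, rfl⟩ := (ValuationRing.dvd_total y z).resolve_right hyz
        have hw : w ∈ maximalIdeal V := by
          rw [mem_maximalIdeal, mem_nonunits_iff]
          exact fun hw ↦ hyz (hw.mul_right_dvd.2 dvd_rfl)
        rw [hℓ.quotient_span_mul (left_ne_zero_of_mul hz0)] at hzx
        rcases le_total (ℓ (V ⧸ Ideal.span {y})) (ℓ (V ⧸ Ideal.span {w})) with h | h
        · refine ⟨y, hy, le_trans ?_ hzx⟩
          rw [pow_succ, mul_assoc, two_mul]
          gcongr
        · refine ⟨w, hw, le_trans ?_ hzx⟩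
          rw [pow_succ, mul_assoc, two_mul]
          gcongr
    obtain ⟨n, hn⟩ := ENNReal.exists_nat_mul_gt hε hxt
    obtain ⟨z, hz, hzx⟩ := key n
    have hle : (2 : ℝ≥0∞) ^ n * ℓ (V ⧸ Ideal.span {z}) ≤ 2 ^ n * ε := by
      refine hzx.trans (hn.le.trans ?_)
      gcongr
      exact_mod_cast Nat.lt_two_pow_self.le
    refine ⟨z, hz, ?_, ?_⟩
    · intro h
      rw [h, ENNReal.mul_top (by simp)] at hzx
      exact hxt (top_le_iff.1 hzx)
    · exact ((ENNReal.mul_le_mul_iff_right (by simp) (by simp)).1 hle).trans le_add_self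

/-- The powers of an element `z` of nearly minimal value form a grid. The first power of `z` in `A`
exceeds its predecessor, which is outside `A`, by at most `ℓ (V/𝔪) + ε`. -/
theorem iInf_quotient_span_le (hℓ : IsLengthFunction ℓ)
    (h0 : ℓ (V ⧸ Ideal.span {(0 : V)}) = ∞)
    (hpos : ∀ y ∈ maximalIdeal V, ℓ (V ⧸ Ideal.span {y}) ≠ 0)
    {x : V} (hx : x ∈ maximalIdeal V) (hxt : ℓ (V ⧸ Ideal.span {x}) ≠ ∞)
    {A : Ideal V} {h : ℝ≥0∞}
    (hA : ∀ b ∉ A, ℓ (V ⧸ Ideal.span {b}) + ℓ (V ⧸ maximalIdeal V) ≤ h) :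
    ⨅ a ∈ A, ℓ (V ⧸ Ideal.span {a}) ≤ h := by
  classical
  refine ENNReal.le_of_forall_pos_le_add fun ε hε hh ↦ ?_
  obtain ⟨z, hz, hzt, hzε⟩ := hℓ.exists_quotient_span_le h0 hx hxt
    (ε := ε) (by exact_mod_cast hε.ne')
  have hz0 := ne_zero_of_quotient_ne_top h0 hzt
  have hex : ∃ n : ℕ, z ^ n ∈ A := by
    obtain ⟨n, hn⟩ := ENNReal.exists_nat_mul_gt (hpos z hz) hh.ne
    refine ⟨n, by_contra fun hzn ↦ hn.not_ge ?_⟩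
    rw [← hℓ.quotient_span_pow hz0]
    exact le_self_add.trans (hA _ hzn)
  have hmem := Nat.find_spec hex
  refine (iInf₂_le _ hmem).trans ?_
  rcases hn : Nat.find hex with _ | n
  · rw [pow_zero, hℓ.quotient_span_one]
    exact bot_le
  · have hnA := hA _ (Nat.find_min hex (m := n) (by omega))
    rw [pow_succ, hℓ.quotient_span_mul (pow_ne_zero _ hz0)]
    calc _ ≤ ℓ (V ⧸ Ideal.span {z ^ n}) + (ℓ (V ⧸ maximalIdeal V) + ε) := by gcongr
      _ = ℓ (V ⧸ Ideal.span {z ^ n}) + ℓ (V ⧸ maximalIdeal V) + ε := (add_assoc _ _ _).symm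
      _ ≤ h + ε := by gcongr

/-- If `b` does not kill `n`, comparability of divisors gives `Ann n ≤ b𝔪`, hence `ℓ (V/bV) + ℓ
(V/𝔪) = ℓ (V/b𝔪) ≤ ℓ N`. -/
theorem iInf_annihilator_le (hℓ : IsLengthFunction ℓ)
    (h0 : ℓ (V ⧸ Ideal.span {(0 : V)}) = ∞)
    (hpos : ∀ y ∈ maximalIdeal V, ℓ (V ⧸ Ideal.span {y}) ≠ 0)
    {x : V} (hx : x ∈ maximalIdeal V) (hxt : ℓ (V ⧸ Ideal.span {x}) ≠ ∞)
    (N : Type u) [AddCommGroup N] [Module V N] :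
    ⨅ a ∈ Module.annihilator V N, ℓ (V ⧸ Ideal.span {a}) ≤ ℓ N := by
  refine hℓ.iInf_quotient_span_le h0 hpos hx hxt fun b hb ↦ ?_
  rw [Module.mem_annihilator] at hb
  push Not at hb
  obtain ⟨n, hn⟩ := hb
  have hb0 : b ≠ 0 := by rintro rfl; simp at hn
  refine le_trans ?_ (hℓ.quotient_torsionOf_le n)
  rw [← hℓ.quotient_span_singleton_mul hb0]
  refine hℓ.quotient_le_of_le fun a ha ↦ ?_
  rw [Ideal.mem_torsionOf_iff] at ha
  rcases ValuationRing.dvd_total a b with ⟨c, rfl⟩ | ⟨c, rfl⟩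
  · rw [mul_comm, mul_smul, ha, smul_zero] at hn
    exact absurd rfl hn
  · refine Ideal.mul_mem_mul (Ideal.mem_span_singleton_self b) ?_
    rw [mem_maximalIdeal, mem_nonunits_iff]
    rintro ⟨c, rfl⟩
    rw [mul_comm, mul_smul] at ha
    exact hn ((smul_eq_zero_iff_eq c).1 ha)

theorem eq_valuativeFunction (hℓ : IsLengthFunction ℓ)
    (h0 : ℓ (V ⧸ Ideal.span {(0 : V)}) = ∞)
    (hpos : ∀ y ∈ maximalIdeal V, ℓ (V ⧸ Ideal.span {y}) ≠ 0)
    {x : V} (hx : x ∈ maximalIdeal V) (hxt : ℓ (V ⧸ Ideal.span {x}) ≠ ∞) :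
    ℓ = valuativeFunction fun y ↦ ℓ (V ⧸ Ideal.span {y}) := by
  funext M _ _
  apply le_antisymm
  · rw [hℓ.upperContinuous M]
    refine iSup₂_le fun N hN ↦ ?_
    obtain ⟨S, rfl⟩ := hN
    obtain ⟨n, g, hg, hg0, hgl, hle⟩ := hℓ.exists_chain_le M S
    refine hle.trans ?_
    unfold valuativeFunction
    -- Chains in `valuativeFunction` must end at `⊤`, so `⊤` is appended if needed; the extra term
    -- is nonnegative.
    by_cases hS : Submodule.span V (S : Set M) = ⊤
    · exact le_iSup_of_le (⟨n, g, hg⟩ : LTSeries (Submodule V M))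
        (le_iSup₂_of_le hg0 (hgl.trans hS) le_rfl)
    · refine le_iSup_of_le (⟨n + 1, Fin.snoc (α := fun _ ↦ Submodule V M) g ⊤, ?_⟩ :
        LTSeries (Submodule V M)) (le_iSup₂_of_le ?_ ?_ ?_)
      · intro i
        change Fin.snoc (α := fun _ ↦ Submodule V M) g ⊤ _ < Fin.snoc (α := fun _ ↦ _) g ⊤ _
        cases i using Fin.lastCases with
        | last =>
          rw [Fin.succ_last, Fin.snoc_last, Fin.snoc_castSucc, hgl]
          exact lt_top_iff_ne_top.2 hS
        | cast i =>
          rw [Fin.succ_castSucc, Fin.snoc_castSucc, Fin.snoc_castSucc]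
          exact hg i
      · change Fin.snoc (α := fun _ ↦ Submodule V M) g ⊤ 0 = ⊥
        rw [← Fin.castSucc_zero, Fin.snoc_castSucc, hg0]
      · change Fin.snoc (α := fun _ ↦ Submodule V M) g ⊤ (Fin.last _) = ⊤
        rw [Fin.snoc_last]
      · change _ ≤ ∑ i : Fin (n + 1), _
        rw [Fin.sum_univ_castSucc]
        refine le_trans (Finset.sum_le_sum fun i _ ↦ ?_) le_self_add
        let c (A B : Submodule V M) : ℝ≥0∞ :=
          ⨅ α ∈ Module.annihilator V (B ⧸ A.submoduleOf B), ℓ (V ⧸ Ideal.span {α})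
        change c (g i.castSucc) (g i.succ) ≤ c (Fin.snoc (α := fun _ ↦ Submodule V M) g ⊤ _)
          (Fin.snoc (α := fun _ ↦ Submodule V M) g ⊤ i.castSucc.succ)
        rw [Fin.succ_castSucc, Fin.snoc_castSucc, Fin.snoc_castSucc]
  · unfold valuativeFunction
    refine iSup_le fun E ↦ iSup₂_le fun hE0 hEl ↦ ?_
    have h1 := last_eq_add_sum (fun i ↦ ℓ (E i))
      (fun i ↦ ℓ (E i.succ ⧸ (E i.castSucc).submoduleOf (E i.succ))) fun i ↦ by
        rw [hℓ.eq_add_quotient ((E i.castSucc).submoduleOf (E i.succ)),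
          hℓ.congr (Submodule.submoduleOfEquivOfLe (E.strictMono Fin.castSucc_lt_succ).le)]
    have h2 : ℓ (E (Fin.last _)) = ℓ M := by
      have : E (Fin.last _) = ⊤ := hEl
      rw [this, hℓ.congr Submodule.topEquiv]
    rw [h2] at h1
    rw [h1]
    refine le_trans (Finset.sum_le_sum fun i _ ↦ ?_) le_add_self
    exact hℓ.iInf_annihilator_le h0 hpos hx hxt _

/-- The trichotomy for length functions on a valuation domain that are nonzero
on some quotient by an ideal whose radical is maximal. -/
theorem trichotomy (hℓ : IsLengthFunction ℓ) {J : Ideal V}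
    (hJ : ∀ y ∈ maximalIdeal V, ∃ n : ℕ, y ^ n ∈ J) (hne : ℓ (V ⧸ J) ≠ 0) :
    ℓ = idempotentSingular (maximalIdeal V) ∨
    (ℓ (V ⧸ maximalIdeal V) ≠ 0 ∧ ∀ (M : Type u) [AddCommGroup M] [Module V M],
      ℓ M = ℓ (V ⧸ maximalIdeal V) * rankFunction (maximalIdeal V) M) ∨
    (ℓ (V ⧸ Ideal.span {(0 : V)}) = ∞ ∧ (∀ y ∈ maximalIdeal V, ℓ (V ⧸ Ideal.span {y}) ≠ 0) ∧
      ∃ x ∈ maximalIdeal V, ℓ (V ⧸ Ideal.span {x}) ≠ ∞) := by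
  -- If `ℓ (V/yV) = 0`, the same holds for all powers of `y`, one of which lies in `J`. The case `y
  -- = 0` is separate because multiplicativity needs `y ≠ 0`.
  have hpos (y : V) (hy : y ∈ maximalIdeal V) : ℓ (V ⧸ Ideal.span {y}) ≠ 0 := by
    intro h
    obtain ⟨n, hn⟩ := hJ y hy
    rcases eq_or_ne y 0 with rfl | hy0
    · refine hne (le_antisymm (h ▸ hℓ.quotient_le_of_le ?_) bot_le)
      rw [Ideal.span_singleton_eq_bot.2 rfl]
      exact bot_le
    · refine hne (le_antisymm (le_trans (hℓ.quotient_le_of_le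
        ((Ideal.span_singleton_le_iff_mem _).2 hn)) ?_) bot_le)
      rw [hℓ.quotient_span_pow hy0, h, mul_zero]
  -- A nonzero nonunit of finite value gives the valuative case; without one, `ℓ (V/K) = ∞` for
  -- every `K` strictly inside the maximal ideal.
  by_cases hx : ∃ x ∈ maximalIdeal V, x ≠ 0 ∧ ℓ (V ⧸ Ideal.span {x}) ≠ ∞
  · obtain ⟨x, hx, hx0, hxt⟩ := hx
    refine .inr (.inr ⟨?_, hpos, x, hx, hxt⟩)
    refine ENNReal.eq_top_of_forall_nnreal_le fun r ↦ ?_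
    obtain ⟨n, hn⟩ := ENNReal.exists_nat_mul_gt (hpos x hx) (ENNReal.coe_ne_top (r := r))
    rw [← hℓ.quotient_span_pow hx0] at hn
    exact hn.le.trans (hℓ.quotient_span_le_of_dvd (dvd_zero _))
  · push Not at hx
    have htop : ∀ K < maximalIdeal V, ℓ (V ⧸ K) = ∞ := by
      intro K hK
      obtain ⟨y, hy, hyK⟩ := SetLike.exists_of_lt hK
      rw [eq_top_iff, ← hx y hy (fun e ↦ hyK (e ▸ K.zero_mem))]
      refine hℓ.quotient_le_of_le fun a ha ↦ ?_
      rw [Ideal.mem_span_singleton]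
      exact (ValuationRing.dvd_total y a).resolve_right
        fun ⟨c, hc⟩ ↦ hyK (hc ▸ K.mul_mem_right _ ha)
    by_cases h0 : ℓ (V ⧸ maximalIdeal V) = 0
    · exact .inl (hℓ.eq_idempotentSingular htop h0)
    · exact .inr (.inl ⟨h0, fun M _ _ ↦ hℓ.eq_mul_rankFunction htop h0 M⟩)

end IsLengthFunction

/-! ### Localizations and membership in the four supports -/

theorem isTorsionBySet_quotient_self {V : Type*} [CommRing V] (m : Ideal V) :
    Module.IsTorsionBySet V (V ⧸ m) m :=
  (Module.isTorsionBySet_quotient_iff m m).2 fun _ _ hr ↦ m.mul_mem_right _ hr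

theorem rankFunction_quotient_self {V : Type u} [CommRing V] (m : Ideal V) [m.IsMaximal] :
    rankFunction m (V ⧸ m) = 1 := by
  have h : Module.IsTorsionBySet V (V ⧸ m) m :=
    isTorsionBySet_quotient_self m
  unfold rankFunction
  rw [dif_pos h]
  have e : h.module = (inferInstance : Module (V ⧸ m) (V ⧸ m)) := by
    refine Module.ext' _ _ fun r x ↦ ?_
    obtain ⟨r, rfl⟩ := Ideal.Quotient.mk_surjective r
    rfl
  rw [e, CommSemiring.rank_self]
  simp

/-- This is the contribution of the one-step chain `0 ⊂ M`. -/
theorem iInf_annihilator_le_valuativeFunction {V : Type u} [CommRing V] (v : V → ℝ≥0∞)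
    (M : Type u) [AddCommGroup M] [Module V M] [Nontrivial M] :
    ⨅ α ∈ Module.annihilator V M, v α ≤ valuativeFunction v M := by
  unfold valuativeFunction
  have hlt : (⊥ : Submodule V M) < ⊤ := bot_lt_top
  refine le_iSup_of_le ((RelSeries.singleton _ (⊥ : Submodule V M)).snoc ⊤ hlt)
    (le_iSup₂_of_le (RelSeries.head_snoc ..) (RelSeries.last_snoc ..) ?_)
  · change _ ≤ ∑ i : Fin 1, _
    rw [Fin.sum_univ_one]
    refine le_iInf₂ fun α hα ↦ iInf₂_le _ ?_
    rw [Module.mem_annihilator] at hα ⊢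
    intro x
    have h1 := hα (Submodule.Quotient.mk ⟨x, trivial⟩)
    rw [← Submodule.Quotient.mk_smul, Submodule.Quotient.mk_eq_zero] at h1
    exact h1

theorem valuativeFunction_eq_zero {V : Type u} [CommRing V] {v : V → ℝ≥0∞} {m : Ideal V}
    {M : Type u} [AddCommGroup M] [Module V M] (hM : Module.IsTorsionBySet V M m)
    (h : ⨅ a ∈ m, v a = 0) : valuativeFunction v M = 0 := by
  unfold valuativeFunction
  simp only [ENNReal.iSup_eq_zero]
  refine fun E _ _ ↦ Finset.sum_eq_zero fun i _ ↦ le_antisymm ?_ bot_le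
  rw [← h]
  refine le_iInf₂ fun a ha ↦ iInf₂_le _ ?_
  rw [Module.mem_annihilator]
  intro x
  obtain ⟨x, rfl⟩ := Submodule.Quotient.mk_surjective _ x
  rw [← Submodule.Quotient.mk_smul, Submodule.Quotient.mk_eq_zero]
  have : a • x = 0 := Subtype.ext (@hM x ⟨a, ha⟩)
  rw [this]
  exact zero_mem _

section Localization

variable {D : Type u} [CommRing D] {ℓ : ModuleFunction D}

namespace RankOneValuationAt

variable {P : PrimeSpectrum D} (v : RankOneValuationAt P)

theorem toFun_mul (x y : LocAt P) : v.toFun (x * y) = v.toFun x + v.toFun y := by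
  simp [toFun]

theorem toFun_eq_top {x : LocAt P} (hx : x ∈ extendIdeal P v.below.asIdeal) :
    v.toFun x = ∞ := by
  rw [toFun, Ideal.Quotient.eq_zero_iff_mem.2 hx]
  exact v.val.map_zero

theorem exists_mem_maximalIdeal : ∃ x ∈ maximalIdeal (LocAt P), v.toFun x ≠ ∞ := by
  obtain ⟨x, h0, ht⟩ := v.nontrivial
  obtain ⟨x, rfl⟩ := Ideal.Quotient.mk_surjective x
  refine ⟨x, ?_, ht⟩
  rw [mem_maximalIdeal, mem_nonunits_iff]
  intro hx
  refine h0 (le_antisymm ?_ bot_le)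
  rw [← v.val.map_one]
  exact (v.le_iff_dvd _ _).2 (hx.map (Ideal.Quotient.mk _)).dvd

end RankOneValuationAt

theorem extendIdeal_self (P : PrimeSpectrum D) :
    extendIdeal P P.asIdeal = maximalIdeal (LocAt P) :=
  IsLocalization.AtPrime.map_eq_maximalIdeal P.asIdeal (LocAt P)

theorem algebraMap_mem_extendIdeal_iff {P Q : PrimeSpectrum D} (h : Q ≤ P) {a : D} :
    algebraMap D (LocAt P) a ∈ extendIdeal P Q.asIdeal ↔ a ∈ Q.asIdeal := by
  have := Ideal.under_map_of_isLocalizationAtPrime P.asIdeal (S := LocAt P) (p := Q.asIdeal) h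
  conv_rhs => rw [← this]
  rfl

theorem smul_quotient_mk (P : PrimeSpectrum D) (J : Ideal (LocAt P)) (a : D) (x : LocAt P) :
    a • Ideal.Quotient.mk J x = Ideal.Quotient.mk J (algebraMap D (LocAt P) a * x) := by
  rw [← Algebra.smul_def]
  rfl

/-- `D/Q` embeds in its localization with torsion cokernel, which has length zero when `ℓ (D/Q)` is
finite; when it is infinite, the embedding alone suffices. -/
theorem IsLengthFunction.localization_quotient (hℓ : IsLengthFunction ℓ) {P Q : PrimeSpectrum D}
    (h : Q ≤ P) : ℓ (LocAt P ⧸ extendIdeal P Q.asIdeal) = ℓ (D ⧸ Q.asIdeal) := by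
  let g : D →ₗ[D] (LocAt P ⧸ extendIdeal P Q.asIdeal) :=
    Algebra.linearMap D (LocAt P ⧸ extendIdeal P Q.asIdeal)
  have hg (a : D) : g a = 0 ↔ a ∈ Q.asIdeal := by
    rw [← algebraMap_mem_extendIdeal_iff h, ← Ideal.Quotient.eq_zero_iff_mem]
    rfl
  let f : (D ⧸ Q.asIdeal) →ₗ[D] (LocAt P ⧸ extendIdeal P Q.asIdeal) :=
    Submodule.liftQ Q.asIdeal g fun a ha ↦ (hg a).2 ha
  have hf : Function.Injective f := by
    rw [← LinearMap.ker_eq_bot]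
    refine Submodule.ker_liftQ_eq_bot _ _ _ fun a ha ↦ (hg a).1 ha
  by_cases ht : ℓ (D ⧸ Q.asIdeal) = ∞
  · rw [ht, eq_top_iff, ← ht]
    exact hℓ.le_of_injective f hf
  refine (hℓ.eq_of_ker_of_coker f ?_ (hℓ.eq_zero_of_torsion ht ?_ ?_)).symm
  · rw [LinearMap.ker_eq_bot.2 hf, hℓ.zero]
  · rintro x ⟨a, ha⟩
    obtain ⟨x, rfl⟩ := Submodule.Quotient.mk_surjective _ x
    change a • _ = _
    have : a • x = 0 := by
      obtain ⟨x, rfl⟩ := Ideal.Quotient.mk_surjective x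
      rw [smul_quotient_mk, Ideal.Quotient.eq_zero_iff_mem]
      exact Ideal.mul_mem_right _ _ (Ideal.mem_map_of_mem _ ha)
    rw [← Submodule.Quotient.mk_smul, this, Submodule.Quotient.mk_zero]
  · intro x
    obtain ⟨x, rfl⟩ := Submodule.Quotient.mk_surjective _ x
    obtain ⟨x, rfl⟩ := Ideal.Quotient.mk_surjective x
    obtain ⟨a, s, rfl⟩ := IsLocalization.exists_mk'_eq P.asIdeal.primeCompl x
    refine ⟨s, fun hs ↦ s.2 (h hs), ?_⟩
    rw [← Submodule.Quotient.mk_smul, Submodule.Quotient.mk_eq_zero]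
    refine ⟨Submodule.Quotient.mk a, ?_⟩
    change Ideal.Quotient.mk _ (algebraMap D (LocAt P) a) = _
    rw [smul_quotient_mk, IsLocalization.mk'_spec']

theorem IsLengthFunction.restrict_residueField (hℓ : IsLengthFunction ℓ) (P : PrimeSpectrum D) :
    LengthDecomposition.restrict (LocAt P) ℓ (LocAt P ⧸ extendIdeal P P.asIdeal) =
      ℓ (D ⧸ P.asIdeal) := by
  rw [restrict_eq, hℓ.localization_quotient le_rfl]

theorem IsLengthFunction.mem_sigmaT (hℓ : IsLengthFunction ℓ) {P : PrimeSpectrum D}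
    (h : ℓ (D ⧸ P.asIdeal) = ∞) : P ∈ sigmaT ℓ := by
  change _ = _
  rw [← hℓ.restrict_residueField P] at h
  rw [extendIdeal_self] at h ⊢
  exact hℓ.restrict.eq_torsionSingular h

/-- Evaluation on the residue field, of rank one, identifies the constant `α`. -/
theorem IsLengthFunction.restrict_eq_mul_rankFunction (hℓ : IsLengthFunction ℓ)
    {P : PrimeSpectrum D} (h : P ∈ sigmaR ℓ) :
    ℓ (D ⧸ P.asIdeal) ≠ 0 ∧ ℓ (D ⧸ P.asIdeal) ≠ ∞ ∧
    ∀ (M : Type u) [AddCommGroup M] [Module (LocAt P) M],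
      LengthDecomposition.restrict (LocAt P) ℓ M =
        ℓ (D ⧸ P.asIdeal) * rankFunction (extendIdeal P P.asIdeal) M := by
  obtain ⟨α, h0, ht, h⟩ := h
  have e : α = ℓ (D ⧸ P.asIdeal) := by
    rw [← hℓ.restrict_residueField P, h, rankFunction_quotient_self, mul_one]
  rw [← e]
  exact ⟨h0, ht, h⟩

/-- Above a prime whose residue ring has finite length, `ℓ` has no pure components. -/
theorem IsLengthFunction.notMem_of_lt (hℓ : IsLengthFunction ℓ) {P Q : PrimeSpectrum D}
    (hQP : Q < P) (hQ : ℓ (D ⧸ Q.asIdeal) ≠ ∞) :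
    P ∉ sigmaT ℓ ∧ P ∉ sigmaI ℓ ∧ P ∉ sigmaR ℓ ∧ P ∉ sigmaV ℓ := by
  have hN : LengthDecomposition.restrict (LocAt P) ℓ (LocAt P ⧸ extendIdeal P Q.asIdeal) ≠ ∞ := by
    rwa [restrict_eq, hℓ.localization_quotient hQP.le]
  obtain ⟨a, haP, haQ⟩ := SetLike.exists_of_lt
    (show Q.asIdeal < P.asIdeal from hQP)
  have htors : ¬ Module.IsTorsionBySet (LocAt P) (LocAt P ⧸ extendIdeal P Q.asIdeal)
      (extendIdeal P P.asIdeal) := by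
    intro h
    have := @h (Ideal.Quotient.mk _ 1) ⟨algebraMap D _ a, Ideal.mem_map_of_mem _ haP⟩
    change Ideal.Quotient.mk _ (algebraMap D _ a * 1) = 0 at this
    rw [mul_one, Ideal.Quotient.eq_zero_iff_mem, algebraMap_mem_extendIdeal_iff hQP.le] at this
    exact haQ this
  have hne : Nontrivial (LocAt P ⧸ extendIdeal P Q.asIdeal) := by
    by_contra h
    rw [not_nontrivial_iff_subsingleton] at h
    exact htors fun _ _ ↦ Subsingleton.elim _ _
  refine ⟨fun h ↦ ?_, fun h ↦ ?_, fun h ↦ ?_, fun h ↦ ?_⟩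
  · rw [show _ = _ from h, torsionSingular, if_neg fun h ↦ htors h.1] at hN
    exact hN rfl
  · rw [show _ = _ from h, idempotentSingular, if_neg htors] at hN
    exact hN rfl
  · obtain ⟨α, h0, -, h⟩ := h
    rw [h, rankFunction, dif_neg htors, ENNReal.mul_top h0] at hN
    exact hN rfl
  · obtain ⟨v, h⟩ := h
    rw [h] at hN
    refine hN (top_le_iff.1 (le_trans ?_ (iInf_annihilator_le_valuativeFunction _ _)))
    -- The annihilator of `D_P / Q D_P` is `Q D_P`, which lies in the prime below `P`, where `v` is
    -- infinite.
    refine le_iInf₂ fun α hα ↦ ?_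
    rw [Ideal.annihilator_quotient] at hα
    rw [v.toFun_eq_top (Ideal.map_mono (v.isGreatest_below.2 hQP) hα)]

variable [IsDomain D]

/-- Let `β` be the infimum of `v` on the maximal ideal. If `β = 0`, then `L_v` kills the residue
field. If `β > 0`, an element `p` with `v p < 2β` is no product of two nonunits, so it generates the
maximal ideal; then `V/p²V` has length `2 ℓ (V/pV) < ∞` but infinite `rk`. -/
theorem IsLengthFunction.disjoint_sigmaR_sigmaV (hℓ : IsLengthFunction ℓ)
    (hD : IsPruferDomain D) {P : PrimeSpectrum D} (hr : P ∈ sigmaR ℓ) (hv : P ∈ sigmaV ℓ) :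
    False := by
  have : ValuationRing (LocAt P) := hD P.asIdeal
  have : IsDomain (LocAt P) := IsLocalization.isDomain_localization P.asIdeal.primeCompl_le_nonZeroDivisors
  obtain ⟨h0, ht, hr⟩ := hℓ.restrict_eq_mul_rankFunction hr
  obtain ⟨v, hv⟩ := hv
  have hres := hℓ.restrict_residueField P
  rw [extendIdeal_self] at hr hres
  have hinf : ⨅ a ∈ maximalIdeal (LocAt P), v.toFun a ≠ 0 := by
    intro h
    rw [hv, valuativeFunction_eq_zero (isTorsionBySet_quotient_self _) h] at hres
    exact h0 hres.symm
  set β := ⨅ a ∈ maximalIdeal (LocAt P), v.toFun a with hβ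
  have hβt : β ≠ ∞ := by
    obtain ⟨x, hx, hxt⟩ := v.exists_mem_maximalIdeal
    exact ne_top_of_le_ne_top hxt (iInf₂_le x hx)
  obtain ⟨p, hp, hpβ⟩ : ∃ p ∈ maximalIdeal (LocAt P), v.toFun p < β + β := by
    have : β < β + β := ENNReal.lt_add_right hβt hinf
    by_contra! h
    exact this.not_ge (le_iInf₂ h)
  have hp0 : p ≠ 0 := by
    rintro rfl
    rw [v.toFun_eq_top (zero_mem _)] at hpβ
    exact not_top_lt hpβ
  have hm : maximalIdeal (LocAt P) = Ideal.span {p} := by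
    refine le_antisymm (fun y hy ↦ ?_) ((Ideal.span_singleton_le_iff_mem _).2 hp)
    rw [Ideal.mem_span_singleton]
    by_contra hpy
    obtain ⟨c, rfl⟩ := (ValuationRing.dvd_total p y).resolve_left hpy
    have hc : c ∈ maximalIdeal (LocAt P) := by
      rw [mem_maximalIdeal, mem_nonunits_iff]
      exact fun hc ↦ hpy (hc.mul_right_dvd.2 dvd_rfl)
    rw [v.toFun_mul] at hpβ
    exact hpβ.not_ge (add_le_add (iInf₂_le y hy) (iInf₂_le c hc))
  have h2 := hℓ.restrict.quotient_span_pow (V := LocAt P) hp0 2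
  rw [← hm, hres, hr, rankFunction, dif_neg, ENNReal.mul_top h0] at h2
  · exact ENNReal.mul_ne_top (by simp) ht h2.symm
  · intro h
    have := @h (Ideal.Quotient.mk _ 1) ⟨p, hp⟩
    change Ideal.Quotient.mk _ (p * 1) = 0 at this
    rw [mul_one, Ideal.Quotient.eq_zero_iff_mem, Ideal.mem_span_singleton] at this
    obtain ⟨c, hc⟩ := this
    have : p * 1 = p * (p * c) := by rw [mul_one, ← mul_assoc, ← pow_two, ← hc]
    exact hp (IsUnit.of_mul_eq_one _ (mul_left_cancel₀ hp0 this).symm)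

/-- The rank-one valuation `y ↦ ℓ (D_P / y D_P)`. -/
theorem IsLengthFunction.mem_sigmaV (hℓ : IsLengthFunction ℓ) (hD : IsPruferDomain D)
    {P : PrimeSpectrum D}
    (h0 : LengthDecomposition.restrict (LocAt P) ℓ (LocAt P ⧸ Ideal.span {(0 : LocAt P)}) = ∞)
    (hpos : ∀ y ∈ maximalIdeal (LocAt P),
      LengthDecomposition.restrict (LocAt P) ℓ (LocAt P ⧸ Ideal.span {y}) ≠ 0)
    {x : LocAt P} (hx : x ∈ maximalIdeal (LocAt P))
    (hxt : LengthDecomposition.restrict (LocAt P) ℓ (LocAt P ⧸ Ideal.span {x}) ≠ ∞) :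
    P ∈ sigmaV ℓ := by
  have : ValuationRing (LocAt P) := hD P.asIdeal
  have : IsDomain (LocAt P) := IsLocalization.isDomain_localization P.asIdeal.primeCompl_le_nonZeroDivisors
  have hκ : IsLengthFunction (LengthDecomposition.restrict (LocAt P) ℓ) := hℓ.restrict
  change ∃ v : RankOneValuationAt P, _ = _
  generalize LengthDecomposition.restrict (LocAt P) ℓ = κ at *
  let w := hκ.addValuation h0
  have hw (y : LocAt P) : w y = κ (LocAt P ⧸ Ideal.span {y}) := rfl
  have hprime : w.supp.IsPrime := by
    refine Ideal.isPrime_iff.2 ⟨fun h ↦ ?_, fun {a b} hab ↦ ?_⟩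
    · have h1 : (1 : LocAt P) ∈ w.supp := h ▸ trivial
      rw [AddValuation.mem_supp_iff, w.map_one] at h1
      exact ENNReal.zero_ne_top h1
    · rw [AddValuation.mem_supp_iff] at *
      rw [AddValuation.mem_supp_iff]
      rw [w.map_mul] at hab
      exact ENNReal.add_eq_top.1 hab
  -- The prime below `P` is where the valuation is infinite.
  let Q : PrimeSpectrum D := ⟨w.supp.under D, hprime.under D⟩
  have hQ : extendIdeal P Q.asIdeal = w.supp :=
    IsLocalization.map_under P.asIdeal.primeCompl (LocAt P) w.supp
  have hQP : Q < P := by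
    have hle : Q ≤ P := by
      have : Q.asIdeal ≤ (maximalIdeal (LocAt P)).under D :=
        Ideal.comap_mono (le_maximalIdeal hprime.ne_top)
      rwa [IsLocalization.AtPrime.under_maximalIdeal (LocAt P) P.asIdeal] at this
    refine lt_of_le_of_ne hle fun e ↦ hxt ?_
    rw [e, extendIdeal_self] at hQ
    rw [hQ, AddValuation.mem_supp_iff] at hx
    exact hx
  have hgreat : IsGreatest {Q : PrimeSpectrum D | Q < P} Q := by
    refine ⟨hQP, fun Q' hQ' ↦ ?_⟩
    by_contra hle
    obtain ⟨a, haQ', haQ⟩ := SetLike.not_le_iff_exists.1 (show ¬ Q'.asIdeal ≤ Q.asIdeal from hle)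
    have hwa : w (algebraMap D (LocAt P) a) ≠ ∞ := fun h ↦ haQ ((AddValuation.mem_supp_iff _ _).2 h)
    refine (show ¬ P.asIdeal ≤ Q'.asIdeal from hQ'.not_ge) fun z hz ↦ ?_
    have hzm : algebraMap D (LocAt P) z ∈ maximalIdeal (LocAt P) :=
      extendIdeal_self P ▸ Ideal.mem_map_of_mem _ hz
    -- Archimedean argument: `a` has finite value, so it divides a power of every `z ∈ P`, and a
    -- prime below `P` containing `a` would contain `P`.
    obtain ⟨n, hn⟩ := ENNReal.exists_nat_mul_gt (hpos _ hzm) hwa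
    have hdvd : algebraMap D (LocAt P) a ∣ algebraMap D (LocAt P) z ^ n := by
      refine (ValuationRing.dvd_total _ _).resolve_right fun h ↦ ?_
      have := hκ.quotient_span_le_of_dvd h
      rw [← hw, w.map_pow, nsmul_eq_mul] at this
      exact hn.not_ge this
    refine Q'.2.mem_of_pow_mem n ((algebraMap_mem_extendIdeal_iff hQ'.le).1 ?_)
    rw [map_pow]
    exact Ideal.mem_of_dvd _ hdvd (Ideal.mem_map_of_mem _ haQ')
  let v : RankOneValuationAt P :=
    { below := Q
      isGreatest_below := hgreat
      val := w.onQuot hQ.le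
      le_iff_dvd := by
        intro a b
        obtain ⟨a, rfl⟩ := Ideal.Quotient.mk_surjective a
        obtain ⟨b, rfl⟩ := Ideal.Quotient.mk_surjective b
        change w a ≤ w b ↔ _
        constructor
        · intro h
          rcases ValuationRing.dvd_total a b with hab | ⟨c, rfl⟩
          · exact map_dvd _ hab
          · by_cases hc : IsUnit c
            · exact map_dvd _ (hc.mul_right_dvd.2 dvd_rfl)
            -- Here `w b + w c ≤ w b` with `w c > 0`, which forces `b` to vanish in the quotient.
            · suffices w b = ⊤ by
                rw [← AddValuation.mem_supp_iff, ← hQ, ← Ideal.Quotient.eq_zero_iff_mem] at this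
                rw [this]
                exact dvd_zero _
              by_contra hb
              rw [w.map_mul] at h
              exact h.not_gt (ENNReal.lt_add_right hb (hpos c hc))
        · rintro ⟨c, hc⟩
          obtain ⟨c, rfl⟩ := Ideal.Quotient.mk_surjective c
          have : w b = w (a * c) := congrArg (w.onQuot hQ.le) hc
          rw [this, w.map_mul]
          exact le_self_add
      nontrivial := ⟨Ideal.Quotient.mk _ x, hpos x hx, hxt⟩ }
  exact ⟨v, hκ.eq_valuativeFunction h0 hpos hx hxt⟩

end Localization

/-! ### Decomposition along the minimal primes of an ideal -/

theorem exists_mul_pow_mem_of_mem_minimalPrimes {R : Type*} [CommRing R] {I P : Ideal R}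
    (hP : P ∈ I.minimalPrimes) {a : R} (ha : a ∈ P) : ∃ t ∉ P, ∃ n : ℕ, t * a ^ n ∈ I := by
  have := hP.1.1
  by_contra! h
  obtain ⟨p, hp, hIp, hdisj⟩ := Ideal.exists_le_prime_disjoint I
    (P.primeCompl ⊔ Submonoid.powers a) (Set.disjoint_left.2 fun x hxI hx ↦ by
      obtain ⟨t, ht, _, ⟨n, rfl⟩, rfl⟩ := Submonoid.mem_sup.1 hx
      exact h t ht n hxI)
  rw [Set.disjoint_left] at hdisj
  have hpP : p ≤ P := fun x hx ↦ by_contra fun hxP ↦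
    hdisj hx (Submonoid.mem_sup_left (show x ∈ P.primeCompl from hxP))
  exact hdisj (hP.2 ⟨hp, hIp⟩ hpP ha) (Submonoid.mem_sup_right (Submonoid.mem_powers a))

/-- Comparability in the valuation ring `D_n`, with denominators cleared. -/
theorem IsPruferDomain.exists_mul_eq {D : Type u} [CommRing D] [IsDomain D]
    (hD : IsPruferDomain D) (n : Ideal D) [n.IsPrime] (a r : D) :
    ∃ t ∉ n, ∃ b, t * a = r * b ∨ t * r = a * b := by
  have := hD n
  have hinj : Function.Injective (algebraMap D (Localization.AtPrime n)) :=
    IsLocalization.injective _ n.primeCompl_le_nonZeroDivisors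
  have key (a r : D) (h : algebraMap D (Localization.AtPrime n) r ∣ algebraMap D _ a) :
      ∃ t ∉ n, ∃ b, t * a = r * b := by
    obtain ⟨c, hc⟩ := h
    obtain ⟨b, s, rfl⟩ := IsLocalization.exists_mk'_eq n.primeCompl c
    refine ⟨s, s.2, b, hinj ?_⟩
    rw [map_mul, hc, map_mul, mul_left_comm, IsLocalization.mk'_spec']
  rcases ValuationRing.dvd_total (algebraMap D (Localization.AtPrime n) r)
    (algebraMap D (Localization.AtPrime n) a) with h | h
  · obtain ⟨t, ht, b, h⟩ := key a r h
    exact ⟨t, ht, b, .inl h⟩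
  · obtain ⟨t, ht, b, h⟩ := key r a h
    exact ⟨t, ht, b, .inr h⟩

namespace IsLengthFunction

section Torsion

variable {D : Type u} [CommRing D] {ℓ : ModuleFunction D}

/-- Dévissage: `N/PN` is a torsion `D/P`-module, and `PN` is killed by the product of the remaining
primes. -/
theorem eq_zero_of_prod_torsion (hℓ : IsLengthFunction ℓ) (s : Finset (PrimeSpectrum D))
    (hs : ∀ P ∈ s, ℓ (D ⧸ P.asIdeal) ≠ ∞) :
    ∀ (N : Type u) [AddCommGroup N] [Module D N],
      (∀ a ∈ ∏ P ∈ s, P.asIdeal, ∀ x : N, a • x = 0) →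
      (∀ P ∈ s, ∀ x : N, ∃ r ∉ P.asIdeal, r • x = 0) → ℓ N = 0 := by
  classical
  induction s using Finset.induction_on with
  | empty =>
    intro N _ _ h _
    have : Subsingleton N := ⟨fun x y ↦ by
      rw [← one_smul D x, ← one_smul D y, h 1 (by simp), h 1 (by simp)]⟩
    exact hℓ.zero N
  | insert P s hP ih =>
    intro N _ _ h ht
    rw [Finset.prod_insert hP] at h
    let N' : Submodule D N := P.asIdeal • ⊤
    rw [hℓ.eq_add_quotient N', ih (fun Q hQ ↦ hs Q (Finset.mem_insert_of_mem hQ)) N' ?_ ?_,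
      hℓ.eq_zero_of_torsion (hs P (Finset.mem_insert_self P s))
        (Module.isTorsionBySet_quotient_ideal_smul N P.asIdeal), add_zero]
    · intro x
      obtain ⟨x, rfl⟩ := Submodule.Quotient.mk_surjective _ x
      obtain ⟨r, hr, hx⟩ := ht P (Finset.mem_insert_self P s) x
      refine ⟨r, hr, ?_⟩
      rw [← Submodule.Quotient.mk_smul, hx, Submodule.Quotient.mk_zero]
    · rintro a ha ⟨x, hx⟩
      refine Subtype.ext ?_
      change a • x = 0
      induction hx using Submodule.smul_induction_on' with
      | smul p hp n _ => rw [smul_smul, mul_comm, h _ (Ideal.mul_mem_mul hp ha)]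
      | add x _ y _ hx hy => rw [smul_add, hx, hy, add_zero]
    · intro Q hQ x
      obtain ⟨r, hr, hx⟩ := ht Q (Finset.mem_insert_of_mem hQ) x
      exact ⟨r, hr, Subtype.ext hx⟩

end Torsion

variable {D : Type u} [CommRing D] [IsDomain D] {ℓ : ModuleFunction D}

/-- The product of the minimal primes kills `N`. Otherwise some `ax ≠ 0`; take a maximal `n ⊇ Ann
(ax)`, a minimal prime `P ≤ n`, and `r ∉ P` killing `x`. In `D_n`, `r ∣ a` would kill `ax`, while `a
∣ r` would put `r` in `P`. -/
theorem eq_zero_of_minimalPrimes_torsion (hℓ : IsLengthFunction ℓ) (hD : IsPruferDomain D)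
    {I : Ideal D} (hI : I.minimalPrimes.Finite)
    (hfin : ∀ P : PrimeSpectrum D, P.asIdeal ∈ I.minimalPrimes → ℓ (D ⧸ P.asIdeal) ≠ ∞)
    (N : Type u) [AddCommGroup N] [Module D N] (hN : Module.IsTorsionBySet D N I)
    (ht : ∀ P : PrimeSpectrum D, P.asIdeal ∈ I.minimalPrimes →
      ∀ x : N, ∃ r ∉ P.asIdeal, r • x = 0) : ℓ N = 0 := by
  have hS : {P : PrimeSpectrum D | P.asIdeal ∈ I.minimalPrimes}.Finite :=
    hI.preimage fun _ _ _ _ h ↦ PrimeSpectrum.ext h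
  have hmem (P : PrimeSpectrum D) : P ∈ hS.toFinset ↔ P.asIdeal ∈ I.minimalPrimes := by simp
  refine hℓ.eq_zero_of_prod_torsion hS.toFinset (fun P hP ↦ hfin P ((hmem P).1 hP)) N
    (fun a ha x ↦ ?_) (fun P hP ↦ ht P ((hmem P).1 hP))
  by_contra hax
  obtain ⟨n, hn, hle⟩ := Ideal.exists_le_maximal (Ideal.torsionOf D N (a • x))
    fun h ↦ hax ((Ideal.torsionOf_eq_top_iff D _).1 h)
  have hIn : I ≤ n := fun i hi ↦ hle (@hN (a • x) ⟨i, hi⟩)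
  have := hn.isPrime
  obtain ⟨P, hP, hPn⟩ := Ideal.exists_minimalPrimes_le hIn
  have hPs : (⟨P, hP.1.1⟩ : PrimeSpectrum D) ∈ hS.toFinset := (hmem _).2 hP
  have haP : a ∈ P := (Ideal.prod_le_inf.trans (Finset.inf_le hPs)) ha
  obtain ⟨r, hr, hrx⟩ := ht ⟨P, hP.1.1⟩ hP x
  obtain ⟨t, htn, b, h | h⟩ := hD.exists_mul_eq n a r
  · refine htn (hle ?_)
    rw [Ideal.mem_torsionOf_iff, smul_smul, h, mul_comm, mul_smul, hrx, smul_zero]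
  · exact (hP.1.1.mem_or_mem (show t * r ∈ P from h ▸ P.mul_mem_right b haP)).elim
      (fun ht ↦ htn (hPn ht)) hr

theorem eq_sum_minimalPrimes (hℓ : IsLengthFunction ℓ) (hD : IsPruferDomain D)
    {I : Ideal D} [Fintype {P : PrimeSpectrum D // P.asIdeal ∈ I.minimalPrimes}]
    (hfin : ∀ P : PrimeSpectrum D, P.asIdeal ∈ I.minimalPrimes → ℓ (D ⧸ P.asIdeal) ≠ ∞)
    (M : Type u) [AddCommGroup M] [Module D M] (hM : Module.IsTorsionBySet D M I) :
    ℓ M = ∑ P : {P : PrimeSpectrum D // P.asIdeal ∈ I.minimalPrimes}, ℓ (LocAt P.1 ⊗[D] M) := by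
  classical
  have hI : I.minimalPrimes.Finite := by
    refine (Set.finite_range (fun P : {P : PrimeSpectrum D // P.asIdeal ∈ I.minimalPrimes} ↦
      P.1.asIdeal)).subset fun P hP ↦ ⟨⟨⟨P, hP.1.1⟩, hP⟩, rfl⟩
  have hMP (P : PrimeSpectrum D) (i : D) (hi : i ∈ I) (y : LocAt P ⊗[D] M) : i • y = 0 := by
    induction y using TensorProduct.induction_on with
    | zero => exact smul_zero i
    | tmul v m => rw [← TensorProduct.tmul_smul, show i • m = 0 from @hM m ⟨i, hi⟩,
        TensorProduct.tmul_zero]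
    | add x y hx hy => rw [smul_add, hx, hy, add_zero]
  rw [← hℓ.pi]
  let φ (P : {P : PrimeSpectrum D // P.asIdeal ∈ I.minimalPrimes}) : M →ₗ[D] LocAt P.1 ⊗[D] M :=
    TensorProduct.mk D (LocAt P.1) M 1
  have hφ (P) : IsLocalizedModule P.1.asIdeal.primeCompl (φ P) :=
    inferInstanceAs (IsLocalizedModule _ (TensorProduct.mk D (LocAt P.1) M 1))
  refine hℓ.eq_of_ker_of_coker (LinearMap.pi φ) ?_ ?_
  · refine hℓ.eq_zero_of_minimalPrimes_torsion hD hI hfin _ ?_ ?_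
    · rintro x ⟨i, hi⟩
      exact Subtype.ext (@hM x ⟨i, hi⟩)
    · rintro P hP ⟨x, hx⟩
      have hx' : φ ⟨P, hP⟩ x = 0 := congrFun hx ⟨P, hP⟩
      rw [IsLocalizedModule.eq_zero_iff P.asIdeal.primeCompl] at hx'
      obtain ⟨s, hs⟩ := hx'
      exact ⟨s, s.2, Subtype.ext hs⟩
  · refine hℓ.eq_zero_of_minimalPrimes_torsion hD hI hfin _ ?_ ?_
    · rintro x ⟨i, hi⟩
      obtain ⟨x, rfl⟩ := Submodule.Quotient.mk_surjective _ x
      have : i • x = 0 := funext fun P ↦ hMP P.1 i hi (x P)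
      change i • _ = _
      rw [← Submodule.Quotient.mk_smul, this, Submodule.Quotient.mk_zero]
    · intro P hP x
      obtain ⟨x, rfl⟩ := Submodule.Quotient.mk_surjective _ x
      -- For `Q ≠ P`, a power of some `a ∈ Q` outside `P` kills `M_Q`. The product of these
      -- multipliers isolates the component at `P`, where a denominator `s` makes it lift to `M`.
      have hc (Q : {Q : PrimeSpectrum D // Q.asIdeal ∈ I.minimalPrimes}) :
          ∃ c ∉ P.asIdeal, Q.1 ≠ P → ∀ y : LocAt Q.1 ⊗[D] M, c • y = 0 := by
        by_cases hQP : Q.1 = P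
        · exact ⟨1, fun h ↦ P.2.ne_top ((Ideal.eq_top_iff_one _).2 h), fun h ↦ absurd hQP h⟩
        have hnle : ¬ Q.1.asIdeal ≤ P.asIdeal := fun h ↦
          hQP (PrimeSpectrum.ext (le_antisymm h (hP.2 Q.2.1 h)))
        obtain ⟨a, haQ, haP⟩ := SetLike.not_le_iff_exists.1 hnle
        obtain ⟨t, ht, n, htn⟩ := exists_mul_pow_mem_of_mem_minimalPrimes Q.2 haQ
        refine ⟨a ^ n, fun h ↦ haP (P.2.mem_of_pow_mem n h), fun _ y ↦ ?_⟩
        have := hφ Q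
        refine IsLocalizedModule.smul_injective (φ Q) (⟨t, ht⟩ : Q.1.asIdeal.primeCompl) ?_
        change t • a ^ n • y = t • (0 : LocAt Q.1 ⊗[D] M)
        rw [smul_smul, hMP Q.1 _ htn, smul_zero]
      choose c hcP hc using hc
      have := hφ ⟨P, hP⟩
      obtain ⟨⟨m, s⟩, hms⟩ := IsLocalizedModule.surj P.asIdeal.primeCompl (φ ⟨P, hP⟩) (x ⟨P, hP⟩)
      refine ⟨(∏ Q, c Q) * s, fun h ↦ ?_, ?_⟩
      · rcases P.2.mem_or_mem h with h | h
        · obtain ⟨Q, -, hQ⟩ := P.2.prod_mem_iff.1 h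
          exact hcP Q hQ
        · exact s.2 h
      · rw [← Submodule.Quotient.mk_smul, Submodule.Quotient.mk_eq_zero]
        refine ⟨(∏ Q, c Q) • m, funext fun Q ↦ ?_⟩
        rw [LinearMap.pi_apply, Pi.smul_apply, map_smul]
        by_cases hQ : Q.1 = P
        · obtain rfl : Q = ⟨P, hP⟩ := Subtype.ext hQ
          rw [← hms, mul_smul]
          rfl
        · have h0 (y : LocAt Q.1 ⊗[D] M) : (∏ Q, c Q) • y = 0 := by
            rw [← Finset.prod_erase_mul _ _ (Finset.mem_univ Q), mul_smul, hc Q hQ, smul_zero]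
          rw [h0, mul_comm, mul_smul, h0, smul_zero]

end IsLengthFunction

/-! ### Summation over the pure support -/

variable {D : Type u} [CommRing D] {ℓ : ModuleFunction D}

/-- The primes at which `ℓ` restricts to one of the four pure types. -/
def pureSupport (ℓ : ModuleFunction D) : Set (PrimeSpectrum D) :=
  sigmaT ℓ ∪ sigmaI ℓ ∪ sigmaR ℓ ∪ sigmaV ℓ

theorem span_one_tmul_one (P : PrimeSpectrum D) (I : Ideal D) :
    Submodule.span (LocAt P) {(1 : LocAt P) ⊗ₜ[D] (1 : D ⧸ I)} = ⊤ := by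
  rw [eq_top_iff]
  rintro y -
  induction y using TensorProduct.induction_on with
  | zero => exact zero_mem _
  | tmul v m =>
    obtain ⟨m, rfl⟩ := Ideal.Quotient.mk_surjective m
    refine Submodule.mem_span_singleton.2 ⟨m • v, ?_⟩
    rw [TensorProduct.smul_tmul', smul_eq_mul, mul_one, TensorProduct.smul_tmul]
    congr 1
    exact (Algebra.smul_def m (1 : D ⧸ I)).trans (mul_one _)
  | add x y hx hy => exact add_mem hx hy

namespace IsLengthFunction

theorem notMem_pureSupport_of_lt (hℓ : IsLengthFunction ℓ) {P Q : PrimeSpectrum D}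
    (hQP : Q < P) (hQ : ℓ (D ⧸ Q.asIdeal) ≠ ∞) : P ∉ pureSupport ℓ := by
  obtain ⟨ht, hi, hr, hv⟩ := hℓ.notMem_of_lt hQP hQ
  rintro (((h | h) | h) | h)
  exacts [ht h, hi h, hr h, hv h]

theorem quotient_le_localization_quotient (hℓ : IsLengthFunction ℓ) {P : PrimeSpectrum D}
    {I : Ideal D} (hI : I ≤ P.asIdeal) : ℓ (D ⧸ P.asIdeal) ≤ ℓ (LocAt P ⊗[D] (D ⧸ I)) := by
  let g : (D ⧸ I) →ₗ[D] (D ⧸ P.asIdeal) := Submodule.factor hI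
  refine le_trans ?_ (hℓ.le_of_surjective (g.lTensor (LocAt P))
    (LinearMap.lTensor_surjective _ (Submodule.factor_surjective hI)))
  refine hℓ.le_of_injective (TensorProduct.mk D (LocAt P) (D ⧸ P.asIdeal) 1) ?_
  rw [← LinearMap.ker_eq_bot, LinearMap.ker_eq_bot']
  intro x hx
  rw [IsLocalizedModule.eq_zero_iff P.asIdeal.primeCompl] at hx
  obtain ⟨s, hs⟩ := hx
  obtain ⟨x, rfl⟩ := Ideal.Quotient.mk_surjective x
  change Ideal.Quotient.mk _ (s * x) = 0 at hs
  rw [Ideal.Quotient.eq_zero_iff_mem] at hs ⊢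
  exact (P.2.mem_or_mem hs).resolve_left s.2

theorem localization_quotient_eq_zero (hℓ : IsLengthFunction ℓ) {P : PrimeSpectrum D}
    {I : Ideal D} (hI : ¬ I ≤ P.asIdeal) : ℓ (LocAt P ⊗[D] (D ⧸ I)) = 0 := by
  obtain ⟨a, haI, haP⟩ := SetLike.not_le_iff_exists.1 hI
  have (y : LocAt P ⊗[D] (D ⧸ I)) : y = 0 := by
    refine IsLocalizedModule.smul_injective (TensorProduct.mk D (LocAt P) (D ⧸ I) 1)
      (⟨a, haP⟩ : P.asIdeal.primeCompl) ?_
    change a • y = a • (0 : LocAt P ⊗[D] (D ⧸ I))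
    induction y using TensorProduct.induction_on with
    | zero => rfl
    | tmul v m =>
      obtain ⟨m, rfl⟩ := Ideal.Quotient.mk_surjective m
      have : a • Ideal.Quotient.mk I m = 0 :=
        Ideal.Quotient.eq_zero_iff_mem.2 (I.mul_mem_right m haI)
      rw [← TensorProduct.tmul_smul, this, TensorProduct.tmul_zero, smul_zero]
    | add x y hx hy => rw [smul_add, hx, hy, smul_zero, add_zero]
  have : Subsingleton (LocAt P ⊗[D] (D ⧸ I)) := ⟨fun x y ↦ (this x).trans (this y).symm⟩
  exact hℓ.zero _

variable [IsDomain D]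

theorem mem_pureSupport (hℓ : IsLengthFunction ℓ) (hD : IsPruferDomain D) {I : Ideal D}
    {P : PrimeSpectrum D} (hP : P.asIdeal ∈ I.minimalPrimes)
    (hne : ℓ (LocAt P ⊗[D] (D ⧸ I)) ≠ 0) : P ∈ pureSupport ℓ := by
  by_cases hfin : ℓ (D ⧸ P.asIdeal) = ∞
  · exact .inl (.inl (.inl (hℓ.mem_sigmaT hfin)))
  have : ValuationRing (LocAt P) := hD P.asIdeal
  have : IsDomain (LocAt P) :=
    IsLocalization.isDomain_localization P.asIdeal.primeCompl_le_nonZeroDivisors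
  let e : LocAt P ⊗[D] (D ⧸ I) := 1 ⊗ₜ 1
  have he (a : D) : algebraMap D (LocAt P) a • e = 1 ⊗ₜ Ideal.Quotient.mk I a := by
    rw [algebraMap_smul, ← TensorProduct.tmul_smul]
    congr 1
    exact (Algebra.smul_def a (1 : D ⧸ I)).trans (mul_one _)
  -- Minimality of `P` makes the annihilator of the generator `1 ⊗ 1` contain a power of each
  -- nonunit, as `trichotomy` requires.
  have hJ (y : LocAt P) (hy : y ∈ maximalIdeal (LocAt P)) :
      ∃ n : ℕ, y ^ n ∈ Ideal.torsionOf (LocAt P) (LocAt P ⊗[D] (D ⧸ I)) e := by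
    obtain ⟨a, s, rfl⟩ := IsLocalization.exists_mk'_eq P.asIdeal.primeCompl y
    have ha : a ∈ P.asIdeal := by
      rw [← algebraMap_mem_extendIdeal_iff le_rfl, extendIdeal_self,
        ← IsLocalization.mk'_spec' (LocAt P) a s]
      exact Ideal.mul_mem_left _ _ hy
    obtain ⟨t, ht, n, htn⟩ := exists_mul_pow_mem_of_mem_minimalPrimes hP ha
    refine ⟨n, ?_⟩
    have hu : IsUnit (algebraMap D (LocAt P) (t * s ^ n)) :=
      IsLocalization.map_units (LocAt P) ((⟨t, ht⟩ : P.asIdeal.primeCompl) * s ^ n)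
    have h0 : algebraMap D (LocAt P) (t * s ^ n) * (IsLocalization.mk' (LocAt P) a s) ^ n =
        algebraMap D (LocAt P) (t * a ^ n) := by
      rw [map_mul, map_mul, mul_assoc, map_pow, map_pow, ← mul_pow, IsLocalization.mk'_spec']
    rw [← Ideal.unit_mul_mem_iff_mem _ hu, h0, Ideal.mem_torsionOf_iff, he,
      Ideal.Quotient.eq_zero_iff_mem.2 htn, TensorProduct.tmul_zero]
  have hκ : IsLengthFunction (LengthDecomposition.restrict (LocAt P) ℓ) := hℓ.restrict
  have hne' : LengthDecomposition.restrict (LocAt P) ℓ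
      (LocAt P ⧸ Ideal.torsionOf (LocAt P) (LocAt P ⊗[D] (D ⧸ I)) e) ≠ 0 := by
    rwa [← hκ.span_singleton, span_one_tmul_one, hκ.congr Submodule.topEquiv, restrict_eq]
  have hres := hℓ.restrict_residueField P
  rw [extendIdeal_self] at hres
  rcases hκ.trichotomy hJ hne' with h | ⟨h0, h⟩ | ⟨h0, hpos, x, hx, hxt⟩
  · refine .inl (.inl (.inr ?_))
    change _ = _
    rwa [extendIdeal_self]
  · refine .inl (.inr ⟨ℓ (D ⧸ P.asIdeal), hres ▸ h0, hfin, fun M _ _ ↦ ?_⟩)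
    rw [extendIdeal_self, ← hres, h]
  · exact .inr (hℓ.mem_sigmaV hD h0 hpos hx hxt)

/-- In the finite case the sums over minimal primes and over the support agree termwise: a minimal
prime outside the support contributes zero, and a support prime that is not minimal cannot contain
`I`. -/
theorem quotient_eq_tsum_pureSupport (hℓ : IsLengthFunction ℓ) (hD : IsPruferDomain D)
    {I : Ideal D} (hI : I.minimalPrimes.Finite) :
    ℓ (D ⧸ I) = ∑' P : pureSupport ℓ, ℓ (LocAt P.1 ⊗[D] (D ⧸ I)) := by
  by_cases hfin : ∀ P : PrimeSpectrum D, P.asIdeal ∈ I.minimalPrimes → ℓ (D ⧸ P.asIdeal) ≠ ∞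
  · have : Finite {P : PrimeSpectrum D // P.asIdeal ∈ I.minimalPrimes} :=
      hI.preimage (f := PrimeSpectrum.asIdeal) fun _ _ _ _ h ↦ PrimeSpectrum.ext h
    let := Fintype.ofFinite {P : PrimeSpectrum D // P.asIdeal ∈ I.minimalPrimes}
    rw [hℓ.eq_sum_minimalPrimes hD hfin (D ⧸ I) (isTorsionBySet_quotient_self I),
      ← tsum_fintype (L := .unconditional _),
      tsum_subtype (pureSupport ℓ) (fun P ↦ ℓ (LocAt P ⊗[D] (D ⧸ I)))]
    refine (tsum_subtype {P : PrimeSpectrum D | P.asIdeal ∈ I.minimalPrimes}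
      (fun P ↦ ℓ (LocAt P ⊗[D] (D ⧸ I)))).trans ?_
    refine tsum_congr fun P ↦ ?_
    by_cases hP : P.asIdeal ∈ I.minimalPrimes
    · rw [Set.indicator_of_mem (s := {P : PrimeSpectrum D | P.asIdeal ∈ I.minimalPrimes}) hP]
      by_cases hne : ℓ (LocAt P ⊗[D] (D ⧸ I)) = 0
      · rw [hne, eq_comm]
        exact Set.indicator_apply_eq_zero.2 fun _ ↦ hne
      · rw [Set.indicator_of_mem (hℓ.mem_pureSupport hD hP hne)]
    · rw [Set.indicator_of_notMem (s := {P : PrimeSpectrum D | P.asIdeal ∈ I.minimalPrimes}) hP, eq_comm]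
      refine Set.indicator_apply_eq_zero.2 fun hmem ↦ ?_
      refine hℓ.localization_quotient_eq_zero fun hIP ↦ ?_
      obtain ⟨Q, hQ, hQP⟩ := Ideal.exists_minimalPrimes_le hIP
      refine hℓ.notMem_pureSupport_of_lt (Q := ⟨Q, hQ.1.1⟩) ?_ (hfin _ hQ) hmem
      refine lt_of_le_of_ne hQP ?_
      rintro rfl
      exact hP hQ
  · push Not at hfin
    obtain ⟨P, hP, htop⟩ := hfin
    have h1 : ℓ (D ⧸ I) = ∞ := top_le_iff.1 (htop ▸ hℓ.quotient_le_of_le hP.1.2)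
    rw [h1, eq_comm, eq_top_iff]
    refine le_trans ?_ (ENNReal.le_tsum
      (⟨P, .inl (.inl (.inl (hℓ.mem_sigmaT htop)))⟩ : pureSupport ℓ))
    rw [← htop]
    exact hℓ.quotient_le_localization_quotient hP.1.2

theorem eq_tsum_pureSupport (hℓ : IsLengthFunction ℓ) (hD : IsPruferDomain D)
    (hfin : ∀ I : Ideal D, I.minimalPrimes.Finite)
    (M : Type u) [AddCommGroup M] [Module D M] :
    ℓ M = ∑' P : pureSupport ℓ, ℓ (LocAt P.1 ⊗[D] M) :=
  hℓ.ext_quotient (IsLengthFunction.tsum fun P : pureSupport ℓ ↦ hℓ.baseChange (LocAt P.1))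
    (fun I ↦ hℓ.quotient_eq_tsum_pureSupport hD (hfin I)) M

/-- Primes lying in several of the four supports do not affect the sum: this can only happen where
the local contribution is zero or infinite. -/
theorem tsum_pureSupport (hℓ : IsLengthFunction ℓ) (hD : IsPruferDomain D)
    (M : Type u) [AddCommGroup M] [Module D M] :
    ∑' P : pureSupport ℓ, ℓ (LocAt P.1 ⊗[D] M) =
      (∑' P : sigmaT ℓ, ℓ (LocAt P.1 ⊗[D] M)) + (∑' P : sigmaI ℓ, ℓ (LocAt P.1 ⊗[D] M)) +
      (∑' P : sigmaR ℓ, ℓ (LocAt P.1 ⊗[D] M)) + (∑' P : sigmaV ℓ, ℓ (LocAt P.1 ⊗[D] M)) := by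
  classical
  let f (P : PrimeSpectrum D) : ℝ≥0∞ := ℓ (LocAt P ⊗[D] M)
  have ht (P) (h : P ∈ sigmaT ℓ) : f P = 0 ∨ f P = ∞ := by
    have : f P = _ := (induced_restrict_eq (T := LocAt P) ℓ M).symm
    rw [this, show _ = _ from h, induced, torsionSingular]
    split_ifs <;> simp
  have hi (P) (h : P ∈ sigmaI ℓ) : f P = 0 ∨ f P = ∞ := by
    have : f P = _ := (induced_restrict_eq (T := LocAt P) ℓ M).symm
    rw [this, show _ = _ from h, induced, idempotentSingular]
    split_ifs <;> simp
  rw [tsum_subtype (pureSupport ℓ) f, tsum_subtype (sigmaT ℓ) f, tsum_subtype (sigmaI ℓ) f,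
    tsum_subtype (sigmaR ℓ) f, tsum_subtype (sigmaV ℓ) f, ← ENNReal.tsum_add, ← ENNReal.tsum_add,
    ← ENNReal.tsum_add]
  refine tsum_congr fun P ↦ ?_
  have hrv : ¬ (P ∈ sigmaR ℓ ∧ P ∈ sigmaV ℓ) := fun h ↦ hℓ.disjoint_sigmaR_sigmaV hD h.1 h.2
  simp only [Set.indicator_apply, pureSupport, Set.mem_union]
  by_cases h1 : P ∈ sigmaT ℓ
  -- Repeating a summand equal to `0` or `∞` changes nothing.
  · rcases ht P h1 with h | h <;> simp [h, h1]
  by_cases h2 : P ∈ sigmaI ℓ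
  · rcases hi P h2 with h | h <;> simp [h, h1, h2]
  by_cases h3 : P ∈ sigmaR ℓ
  · simp [h1, h2, h3, show P ∉ sigmaV ℓ from fun h ↦ hrv ⟨h3, h⟩]
  · simp [h1, h2, h3]

end IsLengthFunction

end LengthDecomposition

theorem mainTheorem9 {D : Type u} [CommRing D] [IsDomain D]
    (hD : IsPruferDomain D)
    (hfin : ∀ I : Ideal D, I.minimalPrimes.Finite)
    (ℓ : ModuleFunction D)
    (hℓ : IsLengthFunction ℓ) :
    (∃ v : (P : sigmaV ℓ) → RankOneValuationAt P.1,
      ∀ P : sigmaV ℓ, restrict (LocAt P.1) ℓ = valuativeFunction (v P).toFun) ∧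
    ∀ v : (P : sigmaV ℓ) → RankOneValuationAt P.1,
      (∀ P : sigmaV ℓ, restrict (LocAt P.1) ℓ = valuativeFunction (v P).toFun) →
      ∀ (M : Type u) [AddCommGroup M] [Module D M],
        ℓ M =
          (∑' P : sigmaT ℓ,
            induced D (LocAt P.1) (torsionSingular (extendIdeal P.1 P.1.asIdeal)) M) +
          (∑' P : sigmaI ℓ,
            induced D (LocAt P.1) (idempotentSingular (extendIdeal P.1 P.1.asIdeal)) M) +
          (∑' P : sigmaR ℓ,
            ℓ (D ⧸ P.1.asIdeal) *
              induced D (LocAt P.1) (rankFunction (extendIdeal P.1 P.1.asIdeal)) M) +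
          (∑' P : sigmaV ℓ,
            induced D (LocAt P.1) (valuativeFunction (v P).toFun) M) := by
  refine ⟨⟨fun P ↦ P.2.choose, fun P ↦ P.2.choose_spec⟩, fun v hv M _ _ ↦ ?_⟩
  rw [hℓ.eq_tsum_pureSupport hD hfin M, hℓ.tsum_pureSupport hD M]
  congr 1
  · congr 1
    · congr 1
      · refine tsum_congr fun P ↦ ?_
        rw [← show _ = _ from P.2, induced_restrict_eq]
      · refine tsum_congr fun P ↦ ?_
        rw [← show _ = _ from P.2, induced_restrict_eq]
    · refine tsum_congr fun P ↦ ?_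
      rw [induced, ← (hℓ.restrict_eq_mul_rankFunction P.2).2.2]
      exact (induced_restrict_eq ℓ M).symm
  · refine tsum_congr fun P ↦ ?_
    rw [← hv P, induced_restrict_eq]
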